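/- Let $M$ be a compact, connected, oriented smooth $7$-manifold with non-empty boundary $\partial M$, and let $\phi$ be a $3$-form on $M$ defining a torsion-free $G_2$-structure: $\phi$ is positive at each point (the $\Lambda^7T^*M$-valued quadratic form $v\mapsto i_v\phi\wedge i_v\phi\wedge\phi$ is positive definite), $d\phi=0$ and $d(*_\phi\phi)=0$, where $*_\phi$ is the Hodge operator of the metric $g_\phi$ in the conformal class of this quadratic form normalised by $|\phi|^2=7$. All forms are smooth (up to the boundary), and $\alpha|_{\partial M}$ denotes the pullback of a form $\alpha$ under the inclusion $\partial M\to M$. Let $\Omega^2_7(M)=\{\alpha\in\Omega^2(M): \text{at each point } \alpha=i_v\phi \text{ for some tangent vector } v\}$ and $$K_\phi=\frac{\{d\alpha_7:\alpha_7\in\Omega^2_7(M)\}\cap\{d\alpha:\alpha\in\Omega^2(M),\ \alpha|_{\partial M}=0\}}{\{d\alpha_7:\alpha_7\in\Omega^2_7(M),\ \alpha_7|_{\partial M}=0\}}.$$ On $\partial M$ let $\rho=\phi|_{\partial M}$ and $\omega=(i_\nu\phi)|_{\partial M}$, with $\nu$ the outward unit normal; let $\Lambda^{2,\partial}_1$ be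 the line spanned by $\omega$, let $\Lambda^{2,\partial}_6=\{i_v\rho: v\in T\partial M\}$ be the image of the bundle map $i_v\omega\mapsto i_v\rho$ (the real parts of the forms of type $(2,0)$), and let $\Omega^{2,\partial}_7$ be the space of $2$-forms on $\partial M$ with values in $\Lambda^{2,\partial}_1\oplus\Lambda^{2,\partial}_6$. Put $$V_\phi=\{\theta\in\Omega^{2,\partial}_7: d\theta=0\},\qquad W_\phi=\{\alpha_7\in\Omega^2_7(M): d\alpha_7=0\},$$ let $\iota:W_\phi\to V_\phi$ be the restriction $\alpha_7\mapsto\alpha_7|_{\partial M}$, and let $p:V_\phi\to H^3(M,\partial M)$ send $\theta$ to the image of its class in $H^2(\partial M)$ under the coboundary map of the pair (real coefficients). Then there is an isomorphism of real vector spaces $$K_\phi\cong \ker p/(\ker p\cap \mathrm{Im}\,\iota),$$ and it can be chosen to send the class of $d\alpha_7$ to the class of $\alpha_7|_{\partial M}$, for each $\alpha_7\in\Omega^2_7(M)$ with $d\alpha_7\in\{d\alpha:\alpha\in\Omega^2(M),\ \alpha|_{\partial M}=0\}$. -/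

import Mathlib

open scoped Manifold ContDiff
open Set

noncomputable section

/-! ### Exterior algebra of a real vector space of dimension seven -/

namespace G2Linear

variable {V : Type*} [AddCommGroup V] [Module ℝ V]

/-- The wedge product of alternating forms (the sum over shuffles, so that
`e¹ ∧ ⋯ ∧ eᵏ` takes the value `1` on the dual frame). -/
def wedge {k l : ℕ} (α : V [⋀^Fin k]→ₗ[ℝ] ℝ) (β : V [⋀^Fin l]→ₗ[ℝ] ℝ) :
    V [⋀^Fin (k + l)]→ₗ[ℝ] ℝ :=
  ((LinearMap.mul' ℝ ℝ).compAlternatingMap (α.domCoprod β)).domDomCongr finSumFinEquiv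

/-- The `7`-form `i_v φ ∧ i_v φ ∧ φ`. -/
def hitchinForm (φ : V [⋀^Fin 3]→ₗ[ℝ] ℝ) (v : V) : V [⋀^Fin 7]→ₗ[ℝ] ℝ :=
  wedge (wedge (φ.curryLeft v) (φ.curryLeft v)) φ

/-- A `3`-form `φ` is positive, with respect to the orientation given by the nonzero `7`-form `μ`,
if the `Λ⁷V*`-valued quadratic form `v ↦ i_v φ ∧ i_v φ ∧ φ` is positive definite. -/
def IsPositive (μ : V [⋀^Fin 7]→ₗ[ℝ] ℝ) (φ : V [⋀^Fin 3]→ₗ[ℝ] ℝ) : Prop :=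
  ∀ v : V, v ≠ 0 → ∃ c : ℝ, 0 < c ∧ hitchinForm φ v = c • μ

/-- `e` is a frame of seven vectors that is orthonormal for the bilinear form `g`. -/
def IsOrthonormalFrame (g : LinearMap.BilinForm ℝ V) (e : Fin 7 → V) : Prop :=
  ∀ i j, g (e i) (e j) = if i = j then 1 else 0

/-- The inner product of two `k`-forms computed in an orthonormal frame `e`
(so that the forms `eⁱ¹ ∧ ⋯ ∧ eⁱᵏ`, `i₁ < ⋯ < iₖ`, are orthonormal). -/
def frameInner {k : ℕ} (e : Fin 7 → V) (α β : V [⋀^Fin k]→ₗ[ℝ] ℝ) : ℝ :=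
  (∑ f : Fin k → Fin 7, α (e ∘ f) * β (e ∘ f)) / (k.factorial : ℝ)

/-- `g` is the Euclidean structure of the positive `3`-form `φ`: the inner product in the
conformal class of `v ↦ i_v φ ∧ i_v φ ∧ φ` that is normalised by `|φ|² = 7`. -/
structure IsAssociatedMetric (μ : V [⋀^Fin 7]→ₗ[ℝ] ℝ) (φ : V [⋀^Fin 3]→ₗ[ℝ] ℝ)
    (g : LinearMap.BilinForm ℝ V) : Prop where
  symm : ∀ u v, g u v = g v u
  pos : ∀ v, v ≠ 0 → 0 < g v v
  conformal : ∃ c : ℝ, 0 < c ∧ ∀ v, hitchinForm φ v = (c * g v v) • μ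
  norm_sq : ∀ e : Fin 7 → V, IsOrthonormalFrame g e → frameInner e φ φ = 7

/-- The Euclidean structure `g_φ`: for a positive `φ` on an oriented `7`-dimensional space,
the unique inner product with the property `IsAssociatedMetric`. -/
def metric (μ : V [⋀^Fin 7]→ₗ[ℝ] ℝ) (φ : V [⋀^Fin 3]→ₗ[ℝ] ℝ) : LinearMap.BilinForm ℝ V :=
  Classical.epsilon (IsAssociatedMetric μ φ)

/-- `τ = *σ` for a `3`-form `σ` and a `4`-form `τ`, where `*` is the Hodge operator of the inner
product `g` and the orientation `μ`: for every `3`-form `α`, `α ∧ τ = ⟨α, σ⟩ vol`; here `vol` is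
the `7`-form with value `1` on positively oriented orthonormal frames. -/
def IsHodgeStar (μ : V [⋀^Fin 7]→ₗ[ℝ] ℝ) (g : LinearMap.BilinForm ℝ V)
    (σ : V [⋀^Fin 3]→ₗ[ℝ] ℝ) (τ : V [⋀^Fin 4]→ₗ[ℝ] ℝ) : Prop :=
  ∀ e : Fin 7 → V, IsOrthonormalFrame g e → 0 < μ e →
    ∀ α : V [⋀^Fin 3]→ₗ[ℝ] ℝ, wedge α τ e = frameInner e α σ

end G2Linear

/-! ### Differential forms on a manifold, possibly with boundary -/

namespace Forms

section Basic

variable {E : Type*} [NormedAddCommGroup E] [NormedSpace ℝ E]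
  {H : Type*} [TopologicalSpace H] (I : ModelWithCorners ℝ E H)
  (M : Type*) [TopologicalSpace M] [ChartedSpace H M]

/-- A family of alternating `k`-forms on the tangent spaces of `M` (no regularity). -/
def FormField (k : ℕ) : Type _ := (x : M) → TangentSpace I x [⋀^Fin k]→L[ℝ] ℝ

instance (k : ℕ) : AddCommGroup (FormField I M k) :=
  inferInstanceAs (AddCommGroup ((x : M) → TangentSpace I x [⋀^Fin k]→L[ℝ] ℝ))

instance (k : ℕ) : Module ℝ (FormField I M k) :=
  inferInstanceAs (Module ℝ ((x : M) → TangentSpace I x [⋀^Fin k]→L[ℝ] ℝ))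

variable {M}

/-- The expression of `σ` in the preferred chart at `x₀`: its pullback under the inverse chart,
a form on the target of the extended chart in the model space. -/
def inChart {k : ℕ} (σ : FormField I M k) (x₀ : M) : E → E [⋀^Fin k]→L[ℝ] ℝ := fun y =>
  (σ ((extChartAt I x₀).symm y)).compContinuousLinearMap
    (mfderivWithin 𝓘(ℝ, E) I (extChartAt I x₀).symm (range I) y)

variable (M)

/-- The space `Ωᵏ(M)` of smooth `k`-forms, smooth up to the boundary. -/
def Smooth (k : ℕ) : Submodule ℝ (FormField I M k) where
  carrier := {σ | ∀ x₀ : M, ContDiffOn ℝ ∞ (inChart I σ x₀) (extChartAt I x₀).target}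
  zero_mem' := fun x₀ => by
    have h : inChart I (0 : FormField I M k) x₀ = fun _ => 0 := by
      rfl
    rw [h]; exact contDiffOn_const
  add_mem' := fun {a b} ha hb x₀ => by
    have h : inChart I (a + b) x₀ = inChart I a x₀ + inChart I b x₀ := by
      rfl
    rw [h]; exact (ha x₀).add (hb x₀)
  smul_mem' := fun c a ha x₀ => by
    have h : inChart I (c • a) x₀ = c • inChart I a x₀ := by
      rfl
    rw [h]; exact (ha x₀).const_smul c

variable {M}

/-- The exterior derivative of a family of forms, computed at `x` in the preferred chart at `x`. -/
def extDerivField {k : ℕ} (σ : FormField I M k) : FormField I M (k + 1) := fun x =>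
  (extDerivWithin (inChart I σ x) (range I) (extChartAt I x x)).compContinuousLinearMap
    (mfderiv I 𝓘(ℝ, E) (extChartAt I x) x)

variable (M)

lemma differentiableWithinAt_inChart {k : ℕ} (σ : Smooth I M k) (x : M) :
    DifferentiableWithinAt ℝ (inChart I σ.1 x) (range I) (extChartAt I x x) :=
  (((σ.2 x).differentiableOn (by simp)) _ (mem_extChartAt_target x)).mono_of_mem_nhdsWithin
    (extChartAt_target_mem_nhdsWithin x)

/-- The exterior derivative `d` on smooth `k`-forms. -/
def d (k : ℕ) : Smooth I M k →ₗ[ℝ] FormField I M (k + 1) where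
  toFun σ := extDerivField I σ.1
  map_add' a b := by
    funext x
    have h : inChart I (a + b : Smooth I M k).1 x = inChart I a.1 x + inChart I b.1 x := by
      rfl
    have hu : UniqueDiffWithinAt ℝ (range I) (extChartAt I x x) :=
      I.uniqueDiffOn _ (mem_range_self _)
    simp only [extDerivField, h]
    rw [extDerivWithin_add hu (differentiableWithinAt_inChart I M a x)
      (differentiableWithinAt_inChart I M b x)]
    rfl
  map_smul' c a := by
    funext x
    have h : inChart I (c • a : Smooth I M k).1 x = c • inChart I a.1 x := by
      rfl
    have hu : UniqueDiffWithinAt ℝ (range I) (extChartAt I x x) :=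
      I.uniqueDiffOn _ (mem_range_self _)
    simp only [extDerivField, h]
    rw [extDerivWithin_smul c _ hu]
    rfl

end Basic

section Boundary

variable {E : Type*} [NormedAddCommGroup E] [NormedSpace ℝ E]
  {H : Type*} [TopologicalSpace H] (I : ModelWithCorners ℝ E H)
  {M : Type*} [TopologicalSpace M] [ChartedSpace H M]
  {E' : Type*} [NormedAddCommGroup E'] [NormedSpace ℝ E']
  {H' : Type*} [TopologicalSpace H'] (I' : ModelWithCorners ℝ E' H')
  {N : Type*} [TopologicalSpace N] [ChartedSpace H' N]

/-- The pullback `j^*` of forms under a map `j : N → M`. If `j` is the inclusion of the boundary,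
this is the restriction `α ↦ α|_∂M`. -/
def restrict (j : N → M) (k : ℕ) : FormField I M k →ₗ[ℝ] FormField I' N k where
  toFun σ := fun q => (σ (j q)).compContinuousLinearMap (mfderiv I' I j q)
  map_add' _ _ := rfl
  map_smul' _ _ := rfl

/-- The `k`-forms `α ∈ Ωᵏ(M)` with `α|_∂M = 0`. -/
def SmoothRel (j : N → M) (k : ℕ) : Submodule ℝ (Smooth I M k) :=
  LinearMap.ker (restrict I I' j k ∘ₗ (Smooth I M k).subtype)

/-- The differential `(γ, θ) ↦ (dγ, j^*γ - dθ)` on `Ωᵏ⁺¹(M) ⊕ Ωᵏ(N)` of the relative de Rham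
complex (mapping cone complex) of `j : N → M`. -/
def relD (j : N → M) (k : ℕ) :
    (Smooth I M (k + 1) × Smooth I' N k) →ₗ[ℝ] (FormField I M (k + 2) × FormField I' N (k + 1)) :=
  (d I M (k + 1) ∘ₗ LinearMap.fst ℝ _ _).prod
    (restrict I I' j (k + 1) ∘ₗ (Smooth I M (k + 1)).subtype ∘ₗ LinearMap.fst ℝ _ _
      - d I' N k ∘ₗ LinearMap.snd ℝ _ _)

/-- The cocycles of degree `k + 1` of the relative de Rham complex. -/
abbrev RelCocycle (j : N → M) (k : ℕ) : Submodule ℝ (Smooth I M (k + 1) × Smooth I' N k) :=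
  LinearMap.ker (relD I I' j k)

/-- The coboundaries of degree `k + 2` of the relative de Rham complex, inside the cocycles. -/
def RelCoboundary (j : N → M) (k : ℕ) : Submodule ℝ (RelCocycle I I' j (k + 1)) :=
  (LinearMap.range (relD I I' j k)).comap
    (((Smooth I M (k + 2)).subtype.prodMap (Smooth I' N (k + 1)).subtype) ∘ₗ
      (RelCocycle I I' j (k + 1)).subtype)

/-- The relative de Rham cohomology `Hᵏ⁺²(M, N)` of `j : N → M`, with real coefficients. -/
def RelCohomology (j : N → M) (k : ℕ) : Type _ :=
  RelCocycle I I' j (k + 1) ⧸ RelCoboundary I I' j k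

instance (j : N → M) (k : ℕ) : AddCommGroup (RelCohomology I I' j k) :=
  inferInstanceAs (AddCommGroup (RelCocycle I I' j (k + 1) ⧸ RelCoboundary I I' j k))

instance (j : N → M) (k : ℕ) : Module ℝ (RelCohomology I I' j k) :=
  inferInstanceAs (Module ℝ (RelCocycle I I' j (k + 1) ⧸ RelCoboundary I I' j k))

/-- The coboundary map of the pair on closed forms: `θ ↦ [(0, -θ)]` from closed `(k+1)`-forms on
`N` to `Hᵏ⁺²(M, N)`. If `Θ ∈ Ωᵏ⁺¹(M)` extends `θ` then `(0, -θ) = (dΘ, 0) - (dΘ, j^*Θ)` is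
cohomologous to `(dΘ, 0)`, so that this is the class of `dΘ`. -/
def coboundary (j : N → M) (k : ℕ) :
    LinearMap.ker (d I' N (k + 1)) →ₗ[ℝ] RelCohomology I I' j k :=
  (RelCoboundary I I' j k).mkQ ∘ₗ
    LinearMap.codRestrict (RelCocycle I I' j (k + 1))
      ((LinearMap.inr ℝ (Smooth I M (k + 2)) (Smooth I' N (k + 1))) ∘ₗ
        (-(LinearMap.ker (d I' N (k + 1))).subtype))
      (fun θ => by
        rw [LinearMap.mem_ker]
        simp [relD, LinearMap.mem_ker.mp θ.2])

end Boundary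

end Forms

/-! ### `G₂`-structures on a 7-manifold with boundary -/

namespace G2Boundary

open Forms G2Linear

variable {M : Type*} [TopologicalSpace M] [ChartedSpace (EuclideanHalfSpace 7) M]
  {N : Type*} [TopologicalSpace N] [ChartedSpace (EuclideanSpace ℝ (Fin 6)) N]

/-- `φ` defines a torsion-free `G₂`-structure on `M` with the orientation given by the nowhere
vanishing `7`-form `μ`: it is positive at each point, `dφ = 0` and `d(*_φ φ) = 0`. -/
structure IsTorsionFree (μ : Smooth (𝓡∂ 7) M 7) (φ : Smooth (𝓡∂ 7) M 3) : Prop where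
  positive : ∀ x, IsPositive (μ.1 x).toAlternatingMap (φ.1 x).toAlternatingMap
  closed : d (𝓡∂ 7) M 3 φ = 0
  coclosed : ∃ ψ : Smooth (𝓡∂ 7) M 4,
    (∀ x, IsHodgeStar (μ.1 x).toAlternatingMap
      (metric (μ.1 x).toAlternatingMap (φ.1 x).toAlternatingMap)
      (φ.1 x).toAlternatingMap (ψ.1 x).toAlternatingMap) ∧
    d (𝓡∂ 7) M 4 ψ = 0

/-- `Ω²₇(M)`: the `2`-forms that at each point are `i_v φ` for a tangent vector `v`. -/
def Omega7 (φ : Smooth (𝓡∂ 7) M 3) : Submodule ℝ (Smooth (𝓡∂ 7) M 2) where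
  carrier := {α | ∀ x, ∃ v : TangentSpace (𝓡∂ 7) x,
    (α.1 x).toAlternatingMap = (φ.1 x).toAlternatingMap.curryLeft v}
  zero_mem' := fun x => ⟨0, (map_zero (φ.1 x).toAlternatingMap.curryLeft).symm⟩
  add_mem' := fun {a b} ha hb x => by
    obtain ⟨u, hu⟩ := ha x
    obtain ⟨v, hv⟩ := hb x
    exact ⟨u + v, by rw [map_add, ← hu, ← hv]; rfl⟩
  smul_mem' := fun c a ha x => by
    obtain ⟨u, hu⟩ := ha x
    exact ⟨c • u, by rw [map_smul, ← hu]; rfl⟩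

/-- The numerator `{dα₇ : α₇ ∈ Ω²₇(M)} ∩ {dα : α ∈ Ω²(M), α|_∂M = 0}` of `K_φ`. -/
def KNum (j : N → M) (φ : Smooth (𝓡∂ 7) M 3) : Submodule ℝ (FormField (𝓡∂ 7) M 3) :=
  (Omega7 φ).map (d (𝓡∂ 7) M 2) ⊓ (SmoothRel (𝓡∂ 7) (𝓡 6) j 2).map (d (𝓡∂ 7) M 2)

/-- The denominator `{dα₇ : α₇ ∈ Ω²₇(M), α₇|_∂M = 0}` of `K_φ`. -/
def KDen (j : N → M) (φ : Smooth (𝓡∂ 7) M 3) : Submodule ℝ (FormField (𝓡∂ 7) M 3) :=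
  (Omega7 φ ⊓ SmoothRel (𝓡∂ 7) (𝓡 6) j 2).map (d (𝓡∂ 7) M 2)

/-- The space `K_φ`. -/
abbrev K (j : N → M) (φ : Smooth (𝓡∂ 7) M 3) : Type _ :=
  KNum j φ ⧸ (KDen j φ).submoduleOf (KNum j φ)

/-- `ν ∈ T_{j(q)}M` is the outward-pointing unit normal, for the metric `g_φ`, at the boundary point
`j(q)`. In the half-space model `{y : 0 ≤ y 0}`, outward means that the coordinate `0` decreases. -/
structure IsOutwardNormal (μ : Smooth (𝓡∂ 7) M 7) (φ : Smooth (𝓡∂ 7) M 3) (j : N → M) (q : N)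
    (ν : TangentSpace (𝓡∂ 7) (j q)) : Prop where
  unit : metric (μ.1 (j q)).toAlternatingMap (φ.1 (j q)).toAlternatingMap ν ν = 1
  normal : ∀ w : TangentSpace (𝓡 6) q,
    metric (μ.1 (j q)).toAlternatingMap (φ.1 (j q)).toAlternatingMap ν
      (mfderiv (𝓡 6) (𝓡∂ 7) j q w) = 0
  outward : EuclideanSpace.proj (𝕜 := ℝ) (0 : Fin 7)
    (mfderiv (𝓡∂ 7) 𝓘(ℝ, EuclideanSpace ℝ (Fin 7)) (extChartAt (𝓡∂ 7) (j q)) (j q) ν) < 0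

/-- `Λ²₁` of the boundary at `q`: the line spanned by `ω = i_ν(φ)|_∂M`, with `ν` the outward unit
normal. -/
def Lambda1 (μ : Smooth (𝓡∂ 7) M 7) (φ : Smooth (𝓡∂ 7) M 3) (j : N → M) (q : N) :
    Submodule ℝ (TangentSpace (𝓡 6) q [⋀^Fin 2]→ₗ[ℝ] ℝ) :=
  Submodule.span ℝ {β | ∃ ν : TangentSpace (𝓡∂ 7) (j q), IsOutwardNormal μ φ j q ν ∧
    β = ((φ.1 (j q)).toAlternatingMap.curryLeft ν).compLinearMap
      (mfderiv (𝓡 6) (𝓡∂ 7) j q).toLinearMap}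

/-- `Λ²₆` of the boundary at `q`: the image of the bundle map `χ₆(i_v ω) = i_v ρ`, where
`ρ = φ|_∂M`, that is, all `i_v ρ`. As `ρ` is the real part of a complex volume form for the complex
structure of `T_q∂M`, these are the real parts of the forms of type `(2,0)`. -/
def Lambda6 (φ : Smooth (𝓡∂ 7) M 3) (j : N → M) (q : N) :
    Submodule ℝ (TangentSpace (𝓡 6) q [⋀^Fin 2]→ₗ[ℝ] ℝ) :=
  LinearMap.range (restrict (𝓡∂ 7) (𝓡 6) j 3 φ.1 q).toAlternatingMap.curryLeft

/-- `Ω²₇` of the boundary: the smooth `2`-forms on the boundary with values in `Λ²₁ ⊕ Λ²₆`. -/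
def Omega7Bdry (μ : Smooth (𝓡∂ 7) M 7) (φ : Smooth (𝓡∂ 7) M 3) (j : N → M) :
    Submodule ℝ (Smooth (𝓡 6) N 2) where
  carrier := {θ | ∀ q, (θ.1 q).toAlternatingMap ∈ Lambda1 μ φ j q ⊔ Lambda6 φ j q}
  zero_mem' := fun _ => Submodule.zero_mem _
  add_mem' := fun ha hb q => Submodule.add_mem _ (ha q) (hb q)
  smul_mem' := fun c _ ha q => Submodule.smul_mem _ c (ha q)

/-- `V_φ`: the closed forms in `Ω²₇` of the boundary. -/
def V (μ : Smooth (𝓡∂ 7) M 7) (φ : Smooth (𝓡∂ 7) M 3) (j : N → M) :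
    Submodule ℝ (Smooth (𝓡 6) N 2) :=
  Omega7Bdry μ φ j ⊓ LinearMap.ker (d (𝓡 6) N 2)

instance (μ : Smooth (𝓡∂ 7) M 7) (φ : Smooth (𝓡∂ 7) M 3) (j : N → M) :
    AddCommGroup (V μ φ j) :=
  Submodule.addCommGroup _

/-- `W_φ`: the closed forms in `Ω²₇(M)`. -/
def W (φ : Smooth (𝓡∂ 7) M 3) : Submodule ℝ (Smooth (𝓡∂ 7) M 2) :=
  Omega7 φ ⊓ LinearMap.ker (d (𝓡∂ 7) M 2)

/-- The image in `V_φ` of the restriction map `ι : W_φ → V_φ`, `α₇ ↦ α₇|_∂M`. -/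
def imIota (μ : Smooth (𝓡∂ 7) M 7) (φ : Smooth (𝓡∂ 7) M 3) (j : N → M) :
    Submodule ℝ (V μ φ j) :=
  ((W φ).map (restrict (𝓡∂ 7) (𝓡 6) j 2 ∘ₗ (Smooth (𝓡∂ 7) M 2).subtype)).comap
    ((Smooth (𝓡 6) N 2).subtype ∘ₗ (V μ φ j).subtype)

/-- The map `p : V_φ → H³(M, ∂M)`: the coboundary of the class of a form in `V_φ`. -/
def p (μ : Smooth (𝓡∂ 7) M 7) (φ : Smooth (𝓡∂ 7) M 3) (j : N → M) :
    V μ φ j →ₗ[ℝ] RelCohomology (𝓡∂ 7) (𝓡 6) j 1 :=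
  coboundary (𝓡∂ 7) (𝓡 6) j 1 ∘ₗ Submodule.inclusion inf_le_right

/-- The kernel of `p`. -/
def kerP (μ : Smooth (𝓡∂ 7) M 7) (φ : Smooth (𝓡∂ 7) M 3) (j : N → M) :
    Submodule ℝ (V μ φ j) :=
  LinearMap.ker (p μ φ j)

/-- `ker p / (ker p ∩ Im ι)`. -/
abbrev KerQuot (μ : Smooth (𝓡∂ 7) M 7) (φ : Smooth (𝓡∂ 7) M 3) (j : N → M) : Type _ :=
  kerP μ φ j ⧸ (kerP μ φ j ⊓ imIota μ φ j).submoduleOf (kerP μ φ j)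

end G2Boundary

end

set_option linter.unusedSectionVars false

noncomputable section

namespace ContinuousAlternatingMap
variable {E F G X : Type*} [NormedAddCommGroup E] [NormedSpace ℝ E]
  [NormedAddCommGroup F] [NormedSpace ℝ F] [NormedAddCommGroup G] [NormedSpace ℝ G]
  [NormedAddCommGroup X] [NormedSpace ℝ X]

/-- Antisymmetrization, as a continuous linear map. -/
def alternatizationCLM (k : ℕ) :
    ContinuousMultilinearMap ℝ (fun _ : Fin k => E) G →L[ℝ] E [⋀^Fin k]→L[ℝ] G :=
  LinearMap.mkContinuous
    { toFun := ContinuousMultilinearMap.alternatization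
      map_add' := map_add _
      map_smul' := fun c f => by
        ext v
        simp [ContinuousMultilinearMap.alternatization_apply_apply, Finset.smul_sum, smul_comm c] }
    (k.factorial : ℝ) fun f => by
      refine ContinuousAlternatingMap.opNorm_le_bound _ (by positivity) fun v => ?_
      simp only [LinearMap.coe_mk, AddHom.coe_mk,
        ContinuousMultilinearMap.alternatization_apply_apply]
      refine (norm_sum_le _ _).trans ((Finset.sum_le_sum
        (g := fun _ => ‖f‖ * ∏ i, ‖v i‖) fun σ _ => ?_).trans ?_)
      · have h : ‖f (v ∘ σ)‖ ≤ ‖f‖ * ∏ i, ‖v i‖ :=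
          (f.le_opNorm (v ∘ σ)).trans_eq (congrArg _ (Equiv.prod_comp σ (fun i => ‖v i‖)))
        rcases Int.units_eq_one_or (Equiv.Perm.sign σ) with h' | h' <;> simpa [h'] using h
      · simp [Fintype.card_perm, mul_assoc]

theorem alternatizationCLM_toContinuousMultilinearMap (k : ℕ) (g : E [⋀^Fin k]→L[ℝ] G) :
    alternatizationCLM k g.toContinuousMultilinearMap = (k.factorial : ℝ) • g := by
  ext v
  have : ∀ σ : Equiv.Perm (Fin k), Equiv.Perm.sign σ • g (v ∘ σ) = g v := fun σ => by
    have := g.toAlternatingMap.map_perm v σ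
    simp only [coe_toAlternatingMap] at this
    rw [this, smul_smul]; simp
  simp [alternatizationCLM, ContinuousMultilinearMap.alternatization_apply_apply, this,
    Fintype.card_perm, Nat.cast_smul_eq_nsmul]

theorem contDiff_compContinuousLinearMap {k : ℕ} {n : WithTop ℕ∞} :
    ContDiff ℝ n (fun p : (F [⋀^Fin k]→L[ℝ] G) × (E →L[ℝ] F) =>
      p.1.compContinuousLinearMap p.2) := by
  have key : (fun p : (F [⋀^Fin k]→L[ℝ] G) × (E →L[ℝ] F) => p.1.compContinuousLinearMap p.2) =
      fun p => (k.factorial : ℝ)⁻¹ • alternatizationCLM k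
        (ContinuousMultilinearMap.compContinuousLinearMapContinuousMultilinear ℝ
          (fun _ : Fin k => E) (fun _ : Fin k => F) G (fun _ => p.2)
          (toContinuousMultilinearMapCLM ℝ p.1)) := by
    funext p
    have h : ContinuousMultilinearMap.compContinuousLinearMapContinuousMultilinear ℝ
        (fun _ : Fin k => E) (fun _ : Fin k => F) G (fun _ => p.2)
        (toContinuousMultilinearMapCLM ℝ p.1) =
        (p.1.compContinuousLinearMap p.2).toContinuousMultilinearMap := rfl
    rw [h, alternatizationCLM_toContinuousMultilinearMap, smul_smul, inv_mul_cancel₀, one_smul]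
    exact_mod_cast k.factorial_ne_zero
  rw [key]
  have h₁ : ContDiff ℝ n (alternatizationCLM (E := E) (G := G) k) := ContinuousLinearMap.contDiff _
  have h₂ : ContDiff ℝ n (toContinuousMultilinearMapCLM ℝ :
      (F [⋀^Fin k]→L[ℝ] G) →L[ℝ] ContinuousMultilinearMap ℝ (fun _ : Fin k => F) G) :=
    ContinuousLinearMap.contDiff _
  refine ContDiff.const_smul _ ?_
  refine h₁.comp ?_
  refine ContDiff.clm_apply ?_ (h₂.comp contDiff_fst)
  exact (ContinuousMultilinearMap.contDiff (ContinuousMultilinearMap.compContinuousLinearMapContinuousMultilinear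
    ℝ (fun _ : Fin k => E) (fun _ : Fin k => F) G)).comp (contDiff_pi.2 fun _ => contDiff_snd)

theorem _root_.ContDiffWithinAt.continuousAlternatingMapComp {k : ℕ} {n : WithTop ℕ∞}
    {g : X → F [⋀^Fin k]→L[ℝ] G} {f : X → E →L[ℝ] F} {s : Set X} {x : X}
    (hg : ContDiffWithinAt ℝ n g s x) (hf : ContDiffWithinAt ℝ n f s x) :
    ContDiffWithinAt ℝ n (fun y => (g y).compContinuousLinearMap (f y)) s x :=
  contDiff_compContinuousLinearMap.contDiffAt.comp_contDiffWithinAt x (hg.prodMk hf)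

end ContinuousAlternatingMap

namespace Forms
open Topology Filter

theorem minSmoothness_two_le_infty : minSmoothness ℝ 2 ≤ (∞ : WithTop ℕ∞) := by
  rw [minSmoothness_of_isRCLikeNormedField]
  exact WithTop.coe_le_coe.2 (le_top : (2 : ℕ∞) ≤ ⊤)

section Pullback

variable {E : Type*} [NormedAddCommGroup E] [NormedSpace ℝ E]
  {H : Type*} [TopologicalSpace H] (I : ModelWithCorners ℝ E H)
  {M : Type*} [TopologicalSpace M] [ChartedSpace H M]
  {E' : Type*} [NormedAddCommGroup E'] [NormedSpace ℝ E']
  {k : ℕ}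

/-- The pullback of a form on `M` under a map `G` from a subset `s` of a normed space. -/
def pullbackWithin (G : E' → M) (s : Set E') (σ : FormField I M k) : E' → E' [⋀^Fin k]→L[ℝ] ℝ :=
  fun u => (σ (G u)).compContinuousLinearMap (mfderivWithin 𝓘(ℝ, E') I G s u)

variable [IsManifold I ∞ M]

instance : IsManifold I 1 M := IsManifold.of_le (n := ∞) (by simp)

theorem inChart_compContinuousLinearMap (σ : FormField I M k) {x₀ x : M}
    (hx : x ∈ (extChartAt I x₀).source) :
    (inChart I σ x₀ (extChartAt I x₀ x)).compContinuousLinearMap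
      (mfderiv I 𝓘(ℝ, E) (extChartAt I x₀) x) = σ x := by
  have key : ∀ x', x' = x → (σ x').compContinuousLinearMap
      ((mfderivWithin 𝓘(ℝ, E) I (extChartAt I x₀).symm (range I) (extChartAt I x₀ x)).comp
        (mfderiv I 𝓘(ℝ, E) (extChartAt I x₀) x)) = σ x := by
    rintro x' rfl
    rw [mfderivWithin_extChartAt_symm_comp_mfderiv_extChartAt' hx]
    rfl
  exact key _ ((extChartAt I x₀).left_inv hx)

theorem pullbackWithin_eq (σ : FormField I M k) {G : E' → M} {s : Set E'} {u : E'} {x₀ : M}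
    (hx : G u ∈ (extChartAt I x₀).source) (hG : MDifferentiableWithinAt 𝓘(ℝ, E') I G s u)
    (hs : UniqueDiffWithinAt ℝ s u) :
    pullbackWithin I G s σ u = (inChart I σ x₀ (extChartAt I x₀ (G u))).compContinuousLinearMap
      (fderivWithin ℝ (extChartAt I x₀ ∘ G) s u) := by
  rw [pullbackWithin, ← mfderivWithin_eq_fderivWithin,
    mfderiv_comp_mfderivWithin u (mdifferentiableAt_extChartAt (by simpa using hx)) hG
      hs.uniqueMDiffWithinAt, ← inChart_compContinuousLinearMap I σ hx]
  rfl

variable {I}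

theorem eventuallyEq_pullbackWithin (σ : FormField I M k) {G : E' → M} {s : Set E'} {u : E'}
    {x₀ : M} (hx : G u ∈ (extChartAt I x₀).source) (hGc : ContinuousWithinAt G s u)
    (hG : ∀ᶠ v in 𝓝[s] u, MDifferentiableWithinAt 𝓘(ℝ, E') I G s v) (hs : UniqueDiffOn ℝ s) :
    pullbackWithin I G s σ =ᶠ[𝓝[s] u] fun v =>
      (inChart I σ x₀ (extChartAt I x₀ (G v))).compContinuousLinearMap
        (fderivWithin ℝ (extChartAt I x₀ ∘ G) s v) := by
  filter_upwards [hG, hGc.preimage_mem_nhdsWithin ((isOpen_extChartAt_source x₀).mem_nhds hx),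
    self_mem_nhdsWithin] with v hv hv' hvs
  exact pullbackWithin_eq I σ hv' hv (hs v hvs)

theorem contDiffWithinAt_extChartAt_comp {G : E' → M} {s : Set E'} {u : E'}
    {x₀ : M} (hx : G u ∈ (extChartAt I x₀).source) (hG : ContMDiffWithinAt 𝓘(ℝ, E') I ∞ G s u) :
    ContDiffWithinAt ℝ ∞ (extChartAt I x₀ ∘ G) s u := by
  rw [← contMDiffWithinAt_iff_contDiffWithinAt]
  exact (contMDiffAt_extChartAt' (by simpa using hx)).comp_contMDiffWithinAt u hG

theorem contDiffWithinAt_pullbackWithin {σ : FormField I M k} {G : E' → M} {s : Set E'} {u : E'}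
    {x₀ : M} (hx : G u ∈ (extChartAt I x₀).source)
    (hσ : ContDiffWithinAt ℝ ∞ (inChart I σ x₀) (range I) (extChartAt I x₀ (G u)))
    (hGu : ContMDiffWithinAt 𝓘(ℝ, E') I ∞ G s u)
    (hG : ∀ᶠ v in 𝓝[s] u, MDifferentiableWithinAt 𝓘(ℝ, E') I G s v)
    (hs : UniqueDiffOn ℝ s) (hu : u ∈ s) :
    ContDiffWithinAt ℝ ∞ (pullbackWithin I G s σ) s u := by
  have hF := contDiffWithinAt_extChartAt_comp hx hGu
  refine ContDiffWithinAt.congr_of_eventuallyEq_of_mem ?_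
    (eventuallyEq_pullbackWithin σ hx hGu.continuousWithinAt hG hs) hu
  refine ContDiffWithinAt.continuousAlternatingMapComp ?_
    (hF.fderivWithin_right hs (by simp) hu)
  exact ContDiffWithinAt.comp (t := range I) (f := extChartAt I x₀ ∘ G) u hσ hF
    fun v _ => mem_range_self _

theorem extDerivWithin_pullbackWithin {σ : FormField I M k} {G : E' → M} {s : Set E'} {u : E'}
    (hσ : ContDiffWithinAt ℝ ∞ (inChart I σ (G u)) (range I) (extChartAt I (G u) (G u)))
    (hGu : ContMDiffWithinAt 𝓘(ℝ, E') I ∞ G s u)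
    (hG : ∀ᶠ v in 𝓝[s] u, MDifferentiableWithinAt 𝓘(ℝ, E') I G s v)
    (hs : UniqueDiffOn ℝ s) (hu : u ∈ s) (hsc : u ∈ closure (interior s)) :
    extDerivWithin (pullbackWithin I G s σ) s u = pullbackWithin I G s (extDerivField I σ) u := by
  have hx : G u ∈ (extChartAt I (G u)).source := mem_extChartAt_source _
  have hF := contDiffWithinAt_extChartAt_comp hx hGu
  rw [(eventuallyEq_pullbackWithin σ hx hGu.continuousWithinAt hG hs).extDerivWithin_eq_of_mem hu]
  have := extDerivWithin_pullback (r := ∞) (t := range I)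
    (f := extChartAt I (G u) ∘ G) (hσ.differentiableWithinAt (by simp)) hF
    minSmoothness_two_le_infty hs hsc hu (fun v _ => mem_range_self _)
  refine this.trans ?_
  rw [pullbackWithin, ← mfderivWithin_eq_fderivWithin,
    mfderiv_comp_mfderivWithin u (mdifferentiableAt_extChartAt (by simp))
      (hGu.mdifferentiableWithinAt (by simp)) (hs u hu).uniqueMDiffWithinAt]
  rfl

variable (I) in
/-- A form is smooth at `x` if its expression in the preferred chart at `x` is. -/
def SmoothAt (σ : FormField I M k) (x : M) : Prop :=
  ContDiffWithinAt ℝ ∞ (inChart I σ x) (range I) (extChartAt I x x)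

theorem eventually_mdifferentiableWithinAt_extChartAt_symm {x₀ : M} {y : E}
    (hy : y ∈ (extChartAt I x₀).target) :
    ∀ᶠ v in 𝓝[range I] y,
      MDifferentiableWithinAt 𝓘(ℝ, E) I (extChartAt I x₀).symm (range I) v := by
  filter_upwards [extChartAt_target_mem_nhdsWithin_of_mem hy] with v hv
  exact mdifferentiableWithinAt_extChartAt_symm hv

theorem contMDiffWithinAt_extChartAt_symm_of_mem {x₀ : M} {y : E}
    (hy : y ∈ (extChartAt I x₀).target) :
    ContMDiffWithinAt 𝓘(ℝ, E) I ∞ (extChartAt I x₀).symm (range I) y :=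
  ((contMDiffOn_extChartAt_symm x₀) y hy).mono_of_mem_nhdsWithin
    (extChartAt_target_mem_nhdsWithin_of_mem hy)

/-- Smoothness does not depend on the chart. -/
theorem contDiffWithinAt_inChart_of_mem {σ : FormField I M k} {x₀ x₁ x : M}
    (h₀ : x ∈ (extChartAt I x₀).source) (h₁ : x ∈ (extChartAt I x₁).source)
    (h : ContDiffWithinAt ℝ ∞ (inChart I σ x₁) (range I) (extChartAt I x₁ x)) :
    ContDiffWithinAt ℝ ∞ (inChart I σ x₀) (range I) (extChartAt I x₀ x) := by
  have hy := (extChartAt I x₀).map_source h₀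
  have hxx := (extChartAt I x₀).left_inv h₀
  exact contDiffWithinAt_pullbackWithin (x₀ := x₁) (by rwa [hxx]) (by rwa [hxx])
    (contMDiffWithinAt_extChartAt_symm_of_mem hy)
    (eventually_mdifferentiableWithinAt_extChartAt_symm hy) I.uniqueDiffOn (mem_range_self _)

theorem smoothAt_iff {σ : FormField I M k} {x₀ x : M} (h₀ : x ∈ (extChartAt I x₀).source) :
    SmoothAt I σ x ↔ ContDiffWithinAt ℝ ∞ (inChart I σ x₀) (range I) (extChartAt I x₀ x) :=
  ⟨contDiffWithinAt_inChart_of_mem h₀ (mem_extChartAt_source x),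
    contDiffWithinAt_inChart_of_mem (mem_extChartAt_source x) h₀⟩

theorem mem_smooth_iff {σ : FormField I M k} : σ ∈ Smooth I M k ↔ ∀ x, SmoothAt I σ x := by
  constructor
  · intro h x
    exact ((h x) _ (mem_extChartAt_target x)).mono_of_mem_nhdsWithin
      (extChartAt_target_mem_nhdsWithin x)
  · intro h x₀ y hy
    have := (smoothAt_iff ((extChartAt I x₀).map_target hy)).1 (h ((extChartAt I x₀).symm y))
    rw [(extChartAt I x₀).right_inv hy] at this
    exact this.mono (extChartAt_target_subset_range x₀)

theorem inChart_extDerivField {σ : FormField I M k} (hσ : ∀ x, SmoothAt I σ x) {x₀ : M} {y : E}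
    (hy : y ∈ (extChartAt I x₀).target) :
    inChart I (extDerivField I σ) x₀ y = extDerivWithin (inChart I σ x₀) (range I) y :=
  (extDerivWithin_pullbackWithin (hσ _) (contMDiffWithinAt_extChartAt_symm_of_mem hy)
    (eventually_mdifferentiableWithinAt_extChartAt_symm hy) I.uniqueDiffOn
    (extChartAt_target_subset_range x₀ hy)
    (I.range_subset_closure_interior (extChartAt_target_subset_range x₀ hy))).symm

theorem inChart_extDerivField_eventuallyEq {σ : FormField I M k} (hσ : ∀ x, SmoothAt I σ x)
    (x : M) : inChart I (extDerivField I σ) x =ᶠ[𝓝[range I] (extChartAt I x x)]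
      extDerivWithin (inChart I σ x) (range I) := by
  filter_upwards [extChartAt_target_mem_nhdsWithin x] with y hy
  exact inChart_extDerivField hσ hy

theorem extDerivField_mem_smooth {σ : FormField I M k} (hσ : σ ∈ Smooth I M k) :
    extDerivField I σ ∈ Smooth I M (k + 1) := by
  rw [mem_smooth_iff] at hσ ⊢
  intro x
  refine ContDiffWithinAt.congr_of_eventuallyEq_of_mem ?_
    (inChart_extDerivField_eventuallyEq hσ x) (mem_range_self _)
  have h₁ : ContDiffWithinAt ℝ ∞ (fderivWithin ℝ (inChart I σ x) (range I)) (range I)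
      (extChartAt I x x) :=
    (hσ x).fderivWithin_right I.uniqueDiffOn (by simp) (mem_range_self _)
  exact (ContinuousAlternatingMap.alternatizeUncurryFinCLM ℝ E ℝ).contDiff.contDiffAt
    |>.comp_contDiffWithinAt _ h₁

theorem extDerivField_extDerivField {σ : FormField I M k} (hσ : σ ∈ Smooth I M k) :
    extDerivField I (extDerivField I σ) = 0 := by
  rw [mem_smooth_iff] at hσ
  funext x
  rw [extDerivField,
    (inChart_extDerivField_eventuallyEq hσ x).extDerivWithin_eq_of_mem (mem_range_self _),
    extDerivWithin_extDerivWithin_apply (hσ x) minSmoothness_two_le_infty I.uniqueDiffOn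
      (I.range_subset_closure_interior (mem_range_self _)) (mem_range_self _)]
  rfl

end Pullback
end Forms

namespace Forms
open Topology Filter

section Restrict

variable {E : Type*} [NormedAddCommGroup E] [NormedSpace ℝ E]
  {H : Type*} [TopologicalSpace H] {I : ModelWithCorners ℝ E H}
  {M : Type*} [TopologicalSpace M] [ChartedSpace H M] [IsManifold I ∞ M]
  {E' : Type*} [NormedAddCommGroup E'] [NormedSpace ℝ E']
  {H' : Type*} [TopologicalSpace H'] {I' : ModelWithCorners ℝ E' H'}
  {N : Type*} [TopologicalSpace N] [ChartedSpace H' N] [IsManifold I' ∞ N]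
  {k : ℕ}

theorem inChart_restrict (σ : FormField I M k) {j : N → M} {q : N} {u : E'}
    (hu : u ∈ (extChartAt I' q).target)
    (hj : MDifferentiableAt I' I j ((extChartAt I' q).symm u)) :
    inChart I' (restrict I I' j k σ) q u =
      pullbackWithin I (j ∘ (extChartAt I' q).symm) (range I') σ u := by
  rw [pullbackWithin, mfderiv_comp_mfderivWithin u hj (mdifferentiableWithinAt_extChartAt_symm hu)
    (I'.uniqueDiffOn _ (extChartAt_target_subset_range q hu)).uniqueMDiffWithinAt]
  rfl

theorem eventually_symm_extChartAt {p : N → Prop} {q : N} (h : ∀ᶠ q' in 𝓝 q, p q') :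
    ∀ᶠ u in 𝓝[range I'] (extChartAt I' q q),
      u ∈ (extChartAt I' q).target ∧ p ((extChartAt I' q).symm u) := by
  have h₁ := (continuousAt_extChartAt_symm (I := I') q).preimage_mem_nhds
    (t := {q' | p q'}) (by rwa [(extChartAt I' q).left_inv (mem_extChartAt_source q)])
  filter_upwards [extChartAt_target_mem_nhdsWithin q, mem_nhdsWithin_of_mem_nhds h₁] with u hu hu'
  exact ⟨hu, hu'⟩

theorem inChart_restrict_eventuallyEq (σ : FormField I M k) {j : N → M} {q : N}
    (hj : ∀ᶠ q' in 𝓝 q, ContMDiffAt I' I ∞ j q') :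
    inChart I' (restrict I I' j k σ) q =ᶠ[𝓝[range I'] (extChartAt I' q q)]
      pullbackWithin I (j ∘ (extChartAt I' q).symm) (range I') σ := by
  filter_upwards [eventually_symm_extChartAt hj] with u hu
  exact inChart_restrict σ hu.1 (hu.2.mdifferentiableAt (by simp))

theorem contMDiffWithinAt_comp_extChartAt_symm {j : N → M} {q : N}
    (hj : ContMDiffAt I' I ∞ j q) :
    ContMDiffWithinAt 𝓘(ℝ, E') I ∞ (j ∘ (extChartAt I' q).symm) (range I')
      (extChartAt I' q q) :=
  ContMDiffAt.comp_contMDiffWithinAt _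
    (by rwa [(extChartAt I' q).left_inv (mem_extChartAt_source q)])
    (contMDiffWithinAt_extChartAt_symm_of_mem (mem_extChartAt_target q))

theorem eventually_mdifferentiableWithinAt_comp_extChartAt_symm {j : N → M} {q : N}
    (hj : ∀ᶠ q' in 𝓝 q, ContMDiffAt I' I ∞ j q') :
    ∀ᶠ u in 𝓝[range I'] (extChartAt I' q q),
      MDifferentiableWithinAt 𝓘(ℝ, E') I (j ∘ (extChartAt I' q).symm) (range I') u := by
  filter_upwards [eventually_symm_extChartAt hj] with u hu
  exact (hu.2.mdifferentiableAt (by simp)).comp_mdifferentiableWithinAt u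
    (mdifferentiableWithinAt_extChartAt_symm hu.1)

theorem SmoothAt.restrict {σ : FormField I M k} {j : N → M} {q : N}
    (hσ : SmoothAt I σ (j q)) (hj : ∀ᶠ q' in 𝓝 q, ContMDiffAt I' I ∞ j q') :
    SmoothAt I' (restrict I I' j k σ) q := by
  have hq := (extChartAt I' q).left_inv (mem_extChartAt_source q)
  refine ContDiffWithinAt.congr_of_eventuallyEq_of_mem ?_
    (inChart_restrict_eventuallyEq σ hj) (mem_range_self _)
  refine contDiffWithinAt_pullbackWithin (x₀ := j q) ?_ ?_
    (contMDiffWithinAt_comp_extChartAt_symm hj.self_of_nhds)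
    (eventually_mdifferentiableWithinAt_comp_extChartAt_symm hj) I'.uniqueDiffOn (mem_range_self _)
  · simp only [Function.comp_apply, hq, mem_extChartAt_source]
  · simp only [Function.comp_apply, hq]; exact hσ

/-- The exterior derivative commutes with pullback. -/
theorem extDerivField_restrict {σ : FormField I M k} {j : N → M} {q : N}
    (hσ : SmoothAt I σ (j q)) (hj : ∀ᶠ q' in 𝓝 q, ContMDiffAt I' I ∞ j q') :
    extDerivField I' (restrict I I' j k σ) q =
      restrict I I' j (k + 1) (extDerivField I σ) q := by
  have hq := (extChartAt I' q).left_inv (mem_extChartAt_source q)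
  rw [extDerivField,
    (inChart_restrict_eventuallyEq σ hj).extDerivWithin_eq_of_mem (mem_range_self _),
    extDerivWithin_pullbackWithin (by simp only [Function.comp_apply, hq]; exact hσ)
    (contMDiffWithinAt_comp_extChartAt_symm hj.self_of_nhds)
    (eventually_mdifferentiableWithinAt_comp_extChartAt_symm hj) I'.uniqueDiffOn (mem_range_self _)
    (I'.range_subset_closure_interior (mem_range_self _)),
    ← inChart_restrict _ (mem_extChartAt_target q)
      (by rw [hq]; exact hj.self_of_nhds.mdifferentiableAt (by simp)),
    inChart_compContinuousLinearMap I' _ (mem_extChartAt_source q)]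

theorem restrict_mem_smooth {σ : FormField I M k} (hσ : σ ∈ Smooth I M k) {j : N → M}
    (hj : ContMDiff I' I ∞ j) : restrict I I' j k σ ∈ Smooth I' N k := by
  rw [mem_smooth_iff] at hσ ⊢
  exact fun q => (hσ (j q)).restrict (Eventually.of_forall hj)

theorem d_restrict (σ : Smooth I M k) {j : N → M} (hj : ContMDiff I' I ∞ j) :
    d I' N k ⟨restrict I I' j k σ.1, restrict_mem_smooth σ.2 hj⟩ =
      restrict I I' j (k + 1) (d I M k σ) := by
  funext q
  exact extDerivField_restrict (mem_smooth_iff.1 σ.2 (j q)) (Eventually.of_forall hj)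

theorem restrict_restrict_of_eventuallyEq {j : N → M} {r : M → N} {q : N}
    (hj : MDifferentiableAt I' I j q) (hr : MDifferentiableAt I I' r (j q))
    (h : ∀ᶠ q' in 𝓝 q, r (j q') = q') (η : FormField I' N k) :
    restrict I I' j k (restrict I' I r k η) q = η q := by
  have h₁ : mfderiv I' I' (r ∘ j) q = ContinuousLinearMap.id ℝ (TangentSpace I' q) := by
    rw [Filter.EventuallyEq.mfderiv_eq (f₁ := r ∘ j) (f := id) h, mfderiv_id]
  rw [mfderiv_comp q hr hj] at h₁
  have key : ∀ q' (D : TangentSpace I' q →L[ℝ] TangentSpace I' q'), q' = q →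
    (∀ v, D v = v) → (η q').compContinuousLinearMap D = η q := by
    rintro q' D rfl hD
    ext v
    simp [Function.comp_def, hD]
  exact key _ _ h.self_of_nhds fun v => DFunLike.congr_fun h₁ v

end Restrict

section Smul

variable {E : Type*} [NormedAddCommGroup E] [NormedSpace ℝ E]
  {H : Type*} [TopologicalSpace H] {I : ModelWithCorners ℝ E H}
  {M : Type*} [TopologicalSpace M] [ChartedSpace H M] [IsManifold I ∞ M]
  {k : ℕ}

/-- The product of a function and a form. -/
def funSmul (f : M → ℝ) (σ : FormField I M k) : FormField I M k := fun x => f x • σ x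

theorem SmoothAt.funSmul {f : M → ℝ} {σ : FormField I M k} {x : M}
    (hf : ContMDiffAt I 𝓘(ℝ, ℝ) ∞ f x) (hσ : SmoothAt I σ x) : SmoothAt I (funSmul f σ) x := by
  have hf' : ContDiffWithinAt ℝ ∞ (f ∘ (extChartAt I x).symm) (range I) (extChartAt I x x) := by
    rw [← contMDiffWithinAt_iff_contDiffWithinAt]
    exact contMDiffWithinAt_comp_extChartAt_symm hf
  exact hf'.smul hσ

theorem SmoothAt.sum {ι : Type*} {s : Finset ι} {σ : ι → FormField I M k} {x : M}
    (h : ∀ i ∈ s, SmoothAt I (σ i) x) : SmoothAt I (∑ i ∈ s, σ i) x :=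
  Finset.sum_induction σ (fun τ => SmoothAt I τ x) (fun _ _ ha hb => ContDiffWithinAt.add ha hb)
    (contDiffWithinAt_const (c := 0)) h

variable (I M k) in
/-- Evaluation of forms at a point. -/
def evalAt (x : M) : FormField I M k →ₗ[ℝ] TangentSpace I x [⋀^Fin k]→L[ℝ] ℝ where
  toFun σ := σ x
  map_add' _ _ := rfl
  map_smul' _ _ := rfl

theorem sum_formField_apply {ι : Type*} (s : Finset ι) (σ : ι → FormField I M k) (x : M) :
    (∑ i ∈ s, σ i) x = ∑ i ∈ s, σ i x :=
  map_sum (evalAt I M k x) σ s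

theorem SmoothAt.congr_of_eventuallyEq {σ τ : FormField I M k} {x : M}
    (h : SmoothAt I σ x) (hτ : ∀ᶠ x' in 𝓝 x, τ x' = σ x') : SmoothAt I τ x := by
  refine ContDiffWithinAt.congr_of_eventuallyEq_of_mem h ?_ (mem_range_self _)
  filter_upwards [eventually_symm_extChartAt (I' := I) hτ] with u hu
  rw [inChart, hu.2]; rfl

end Smul
end Forms

namespace G2Linear

variable {V : Type*} [AddCommGroup V] [Module ℝ V]

/-- The wedge product as a bilinear map. -/
def wedgeBilin (k l : ℕ) :
    (V [⋀^Fin k]→ₗ[ℝ] ℝ) →ₗ[ℝ] (V [⋀^Fin l]→ₗ[ℝ] ℝ) →ₗ[ℝ] V [⋀^Fin (k + l)]→ₗ[ℝ] ℝ :=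
  LinearMap.mk₂ ℝ wedge
    (fun a b c => by
      ext v
      simp only [wedge, ← AlternatingMap.domCoprod'_apply, TensorProduct.add_tmul, map_add]
      simp)
    (fun a b c => by
      ext v
      simp only [wedge, ← AlternatingMap.domCoprod'_apply, ← TensorProduct.smul_tmul', map_smul]
      simp)
    (fun a b c => by
      ext v
      simp only [wedge, ← AlternatingMap.domCoprod'_apply, TensorProduct.tmul_add, map_add]
      simp)
    (fun a b c => by
      ext v
      simp only [wedge, ← AlternatingMap.domCoprod'_apply, TensorProduct.tmul_smul, map_smul]
      simp)

@[simp]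
theorem wedgeBilin_apply {k l : ℕ} (a : V [⋀^Fin k]→ₗ[ℝ] ℝ) (b : V [⋀^Fin l]→ₗ[ℝ] ℝ) :
    wedgeBilin k l a b = wedge a b :=
  rfl

/-- A wedge product vanishes on a tuple if each of its shuffle terms does. -/
theorem wedge_apply_eq_zero {k l : ℕ} (a : V [⋀^Fin k]→ₗ[ℝ] ℝ) (b : V [⋀^Fin l]→ₗ[ℝ] ℝ)
    (w : Fin (k + l) → V)
    (h : ∀ σ : Fin k ⊕ Fin l ≃ Fin (k + l),
      a (fun i => w (σ (Sum.inl i))) * b (fun i => w (σ (Sum.inr i))) = 0) :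
    wedge a b w = 0 := by
  have h₁ : a.domCoprod b (fun i => w (finSumFinEquiv i)) = 0 := by
    rw [AlternatingMap.domCoprod_apply, sum_apply]
    refine Finset.sum_eq_zero fun σ _ => ?_
    induction σ using Quotient.inductionOn' with | _ σ
    rw [AlternatingMap.domCoprod.summand_mk'']
    have := h (σ.trans finSumFinEquiv)
    have h₂ : (MultilinearMap.domCoprod (a : MultilinearMap ℝ (fun _ => V) ℝ)
        (b : MultilinearMap ℝ (fun _ => V) ℝ)).domDomCongr σ (fun i => w (finSumFinEquiv i)) = 0 := by
      rw [MultilinearMap.domDomCongr_apply, MultilinearMap.domCoprod_apply]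
      simp only [Equiv.trans_apply] at this
      rcases mul_eq_zero.1 this with h' | h'
      · simp [h']
      · simp [h']
    rw [smul_apply, h₂, smul_zero]
  have h₂ : wedge a b w = LinearMap.mul' ℝ ℝ (a.domCoprod b (fun i => w (finSumFinEquiv i))) := rfl
  rw [h₂, h₁, map_zero]

/-- If a `2`-form vanishes on a hyperplane then its square is zero. -/
theorem wedge_self_eq_zero [FiniteDimensional ℝ V] {U : Type*} [AddCommGroup U] [Module ℝ U]
    [FiniteDimensional ℝ U] (D : U →ₗ[ℝ] V) (hD : Function.Injective D)
    (hdim : Module.finrank ℝ V = Module.finrank ℝ U + 1) (β : V [⋀^Fin 2]→ₗ[ℝ] ℝ)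
    (hβ : β.compLinearMap D = 0) : wedge β β = 0 := by
  obtain ⟨n, hn⟩ : ∃ n, Module.finrank ℝ U = n := ⟨_, rfl⟩
  let bU := Module.finBasisOfFinrankEq ℝ U hn
  have hlt : LinearMap.range D ≠ ⊤ := by
    intro h
    have := LinearMap.finrank_range_of_inj hD
    rw [h, finrank_top] at this
    omega
  obtain ⟨ν, hν⟩ : ∃ ν, ν ∉ LinearMap.range D := by
    by_contra! h
    exact hlt (eq_top_iff.2 fun v _ => h v)
  have hli : LinearIndependent ℝ (Fin.cons ν (D ∘ bU) : Fin (n + 1) → V) := by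
    refine LinearIndependent.finCons (bU.linearIndependent.map' D (LinearMap.ker_eq_bot.2 hD)) ?_
    intro h
    refine hν (Submodule.span_le.2 ?_ h)
    rintro _ ⟨i, rfl⟩
    exact ⟨_, rfl⟩
  let b := basisOfLinearIndependentOfCardEqFinrank hli (by simp [hdim, hn])
  have hb : ∀ i, b i.succ = D (bU i) := fun i => by simp [b]
  have hβ0 : ∀ u v : U, β ![D u, D v] = 0 := fun u v => by
    have := DFunLike.congr_fun hβ ![u, v]
    rw [AlternatingMap.compLinearMap_apply] at this
    rw [AlternatingMap.zero_apply] at this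
    rw [← this]; congr 1; ext i; fin_cases i <;> rfl
  refine b.ext_alternating fun f hf => ?_
  rw [AlternatingMap.zero_apply]
  refine wedge_apply_eq_zero β β _ fun σ => ?_
  have hz : ∀ g : Fin 2 → Fin (n + 1), (∀ i, g i ≠ 0) → β (fun i => b (g i)) = 0 := by
    intro g hg
    obtain ⟨i₀, h₀⟩ := Fin.exists_succ_eq.2 (hg 0)
    obtain ⟨i₁, h₁⟩ := Fin.exists_succ_eq.2 (hg 1)
    rw [← hβ0 (bU i₀) (bU i₁)]
    congr 1
    ext i; fin_cases i
    · simp [← h₀, hb]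
    · simp [← h₁, hb]
  by_cases h : ∀ i, f (σ (Sum.inl i)) ≠ 0
  · rw [hz (fun i => f (σ (Sum.inl i))) h, zero_mul]
  · push Not at h
    obtain ⟨i, hi⟩ := h
    rw [hz (fun i => f (σ (Sum.inr i))), mul_zero]
    intro i' hi'
    have := σ.injective (hf (hi.trans hi'.symm))
    simp at this

theorem hitchinForm_ne_zero {μ : V [⋀^Fin 7]→ₗ[ℝ] ℝ} (hμ : μ ≠ 0) {φ : V [⋀^Fin 3]→ₗ[ℝ] ℝ}
    (hφ : IsPositive μ φ) {v : V} (hv : v ≠ 0) : hitchinForm φ v ≠ 0 := by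
  obtain ⟨c, hc, h⟩ := hφ v hv
  rw [h]
  exact smul_ne_zero hc.ne' hμ

/-- For a positive `3`-form `φ`, the restriction of `i_v φ` to a hyperplane determines `v`. -/
theorem eq_zero_of_curryLeft_compLinearMap_eq_zero [FiniteDimensional ℝ V] {U : Type*}
    [AddCommGroup U] [Module ℝ U] [FiniteDimensional ℝ U] {D : U →ₗ[ℝ] V}
    (hD : Function.Injective D) (hdim : Module.finrank ℝ V = Module.finrank ℝ U + 1)
    {μ : V [⋀^Fin 7]→ₗ[ℝ] ℝ} (hμ : μ ≠ 0) {φ : V [⋀^Fin 3]→ₗ[ℝ] ℝ} (hφ : IsPositive μ φ) {v : V}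
    (hv : (φ.curryLeft v).compLinearMap D = 0) : v = 0 := by
  by_contra hv0
  refine hitchinForm_ne_zero hμ hφ hv0 ?_
  have h := wedge_self_eq_zero D hD hdim _ hv
  rw [hitchinForm, h, ← wedgeBilin_apply, map_zero, LinearMap.zero_apply]

end G2Linear

namespace G2Linear

variable {V : Type*} [AddCommGroup V] [Module ℝ V]

section Frames

variable {g : LinearMap.BilinForm ℝ V}

theorem IsOrthonormalFrame.linearIndependent {e : Fin 7 → V} (he : IsOrthonormalFrame g e) :
    LinearIndependent ℝ e := by
  rw [Fintype.linearIndependent_iff]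
  intro c hc i
  have := congrArg (g (e i)) hc
  simpa [map_sum, he i] using this

theorem IsOrthonormalFrame.sum_eq (hV : Module.finrank ℝ V = 7) {e : Fin 7 → V}
    (he : IsOrthonormalFrame g e) (v : V) : ∑ i, g (e i) v • e i = v := by
  let b := basisOfLinearIndependentOfCardEqFinrank he.linearIndependent (by simp [hV])
  have hb : ⇑b = e := by simp [b]
  have hr : ∀ i, g (e i) v = b.repr v i := fun i => by
    conv_lhs => rw [← b.sum_repr v]
    simp [map_sum, hb, he i]
  simp_rw [hr, ← hb]
  exact b.sum_repr v

theorem IsOrthonormalFrame.sum_mul (hg : ∀ u v, g u v = g v u) (hV : Module.finrank ℝ V = 7)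
    {e e' : Fin 7 → V} (he : IsOrthonormalFrame g e) (he' : IsOrthonormalFrame g e')
    (i k : Fin 7) : ∑ j, g (e i) (e' j) * g (e k) (e' j) = if i = k then 1 else 0 := by
  rw [← he i k]
  conv_rhs => rw [← he'.sum_eq hV (e k)]
  rw [map_sum]
  refine Finset.sum_congr rfl fun j _ => ?_
  rw [map_smul, hg (e k), smul_eq_mul, mul_comm]

/-- The inner product of forms does not depend on the orthonormal frame. -/
theorem frameInner_eq {k : ℕ} (hg : ∀ u v, g u v = g v u) (hV : Module.finrank ℝ V = 7)
    {e e' : Fin 7 → V} (he : IsOrthonormalFrame g e) (he' : IsOrthonormalFrame g e')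
    (α β : V [⋀^Fin k]→ₗ[ℝ] ℝ) : frameInner e' α β = frameInner e α β := by
  have hexp : ∀ (γ : V [⋀^Fin k]→ₗ[ℝ] ℝ) (f : Fin k → Fin 7),
      γ (e' ∘ f) = ∑ h : Fin k → Fin 7, (∏ i, g (e (h i)) (e' (f i))) * γ (e ∘ h) := by
    intro γ f
    have h₁ : e' ∘ f = fun i => ∑ a, g (e a) (e' (f i)) • e a := by
      funext i
      exact (he.sum_eq hV _).symm
    rw [h₁, ← AlternatingMap.coe_multilinearMap, MultilinearMap.map_sum]
    refine Finset.sum_congr rfl fun h _ => ?_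
    rw [MultilinearMap.map_smul_univ, smul_eq_mul]
    rfl
  have horth : ∀ h h' : Fin k → Fin 7, ∑ f : Fin k → Fin 7,
      (∏ i, g (e (h i)) (e' (f i))) * (∏ i, g (e (h' i)) (e' (f i))) =
        if h = h' then 1 else 0 := by
    intro h h'
    simp_rw [← Finset.prod_mul_distrib]
    have := Finset.prod_univ_sum (fun _ : Fin k => (Finset.univ : Finset (Fin 7)))
      (fun i j => g (e (h i)) (e' j) * g (e (h' i)) (e' j))
    rw [Fintype.piFinset_univ] at this
    rw [← this]
    simp_rw [he.sum_mul hg hV he']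
    split_ifs with hh
    · subst hh; simp
    · obtain ⟨i, hi⟩ := Function.ne_iff.1 hh
      exact Finset.prod_eq_zero (Finset.mem_univ i) (if_neg hi)
  unfold frameInner
  congr 1
  calc ∑ f, α (e' ∘ f) * β (e' ∘ f)
      = ∑ f : Fin k → Fin 7, ∑ h : Fin k → Fin 7, ∑ h' : Fin k → Fin 7,
          ((∏ i, g (e (h i)) (e' (f i))) * (∏ i, g (e (h' i)) (e' (f i)))) *
            (α (e ∘ h) * β (e ∘ h')) := by
        refine Finset.sum_congr rfl fun f _ => ?_
        rw [hexp α, hexp β, Finset.sum_mul_sum]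
        exact Finset.sum_congr rfl fun h _ => Finset.sum_congr rfl fun h' _ => by ring
    _ = ∑ h : Fin k → Fin 7, ∑ h' : Fin k → Fin 7,
          (if h = h' then 1 else 0) * (α (e ∘ h) * β (e ∘ h')) := by
        rw [Finset.sum_comm]
        refine Finset.sum_congr rfl fun h _ => ?_
        rw [Finset.sum_comm]
        refine Finset.sum_congr rfl fun h' _ => ?_
        rw [← Finset.sum_mul, horth]
    _ = ∑ h, α (e ∘ h) * β (e ∘ h) := by simp

theorem frameInner_smul {k : ℕ} (c : ℝ) (e : Fin 7 → V) (α : V [⋀^Fin k]→ₗ[ℝ] ℝ) :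
    frameInner (fun i => c • e i) α α = (c ^ 2) ^ k * frameInner e α α := by
  have h : ∀ f : Fin k → Fin 7, α ((fun i => c • e i) ∘ f) = c ^ k * α (e ∘ f) := fun f => by
    have := α.toMultilinearMap.map_smul_univ (fun _ => c) (e ∘ f)
    change α (fun i => c • (e ∘ f) i) = _
    simpa using this
  simp_rw [frameInner, h, ← mul_div_assoc, Finset.mul_sum]
  congr 1
  exact Finset.sum_congr rfl fun f _ => by ring

theorem frameInner_self_pos {k : ℕ} (hV : Module.finrank ℝ V = 7) {e : Fin 7 → V}
    (he : IsOrthonormalFrame g e) {α : V [⋀^Fin k]→ₗ[ℝ] ℝ} (hα : α ≠ 0) :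
    0 < frameInner e α α := by
  let b := basisOfLinearIndependentOfCardEqFinrank he.linearIndependent (by simp [hV])
  have hb : ⇑b = e := by simp [b]
  obtain ⟨f, hf⟩ : ∃ f : Fin k → Fin 7, α (e ∘ f) ≠ 0 := by
    by_contra! h
    refine hα (b.ext_alternating fun f _ => ?_)
    rw [hb]; exact h f
  refine div_pos ?_ (by positivity)
  exact Finset.sum_pos' (fun f _ => mul_self_nonneg _)
    ⟨f, Finset.mem_univ _, mul_self_pos.2 hf⟩

theorem exists_isOrthonormalFrame (hg : ∀ u v, g u v = g v u) (hpos : ∀ v, v ≠ 0 → 0 < g v v)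
    (hV : Module.finrank ℝ V = 7) : ∃ e : Fin 7 → V, IsOrthonormalFrame g e := by
  have : FiniteDimensional ℝ V := Module.finite_of_finrank_pos (by omega)
  obtain ⟨v, hv⟩ := LinearMap.BilinForm.exists_orthogonal_basis (B := g) ⟨fun u v => hg u v⟩
  let b := v.reindex (finCongr hV)
  have hb : ∀ i j, i ≠ j → g (b i) (b j) = 0 := fun i j hij => by
    have := hv (i := (finCongr hV).symm i) (j := (finCongr hV).symm j) (by simpa using hij)
    simpa [b] using this
  have hp : ∀ i, 0 < g (b i) (b i) := fun i => hpos _ (b.ne_zero i)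
  refine ⟨fun i => (Real.sqrt (g (b i) (b i)))⁻¹ • b i, fun i j => ?_⟩
  simp only [map_smul, LinearMap.smul_apply, smul_eq_mul]
  split_ifs with h
  · subst h
    have := Real.mul_self_sqrt (hp i).le
    have h0 := (Real.sqrt_pos.2 (hp i)).ne'
    field_simp
    rw [sq, this]
  · simp [hb i j h]

end Frames

/-- The bilinear form with `i_u φ ∧ i_v φ ∧ φ = B(u, v) μ`, computed on a frame `e`. -/
def hitchinBilin (μ : V [⋀^Fin 7]→ₗ[ℝ] ℝ) (φ : V [⋀^Fin 3]→ₗ[ℝ] ℝ) (e : Fin 7 → V) :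
    LinearMap.BilinForm ℝ V :=
  ((wedgeBilin 2 2).compl₁₂ φ.curryLeft φ.curryLeft).compr₂
    ({ toFun := fun τ => (μ e)⁻¹ * wedgeBilin (2 + 2) 3 τ φ e
       map_add' := fun a b => by
        rw [map_add, LinearMap.add_apply, AlternatingMap.add_apply, mul_add]
       map_smul' := fun c a => by
        rw [map_smul, LinearMap.smul_apply, AlternatingMap.smul_apply, smul_eq_mul, smul_eq_mul,
          mul_left_comm, RingHom.id_apply] } : (V [⋀^Fin (2 + 2)]→ₗ[ℝ] ℝ) →ₗ[ℝ] ℝ)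

theorem hitchinBilin_self (μ : V [⋀^Fin 7]→ₗ[ℝ] ℝ) (φ : V [⋀^Fin 3]→ₗ[ℝ] ℝ) (e : Fin 7 → V)
    (v : V) : hitchinBilin μ φ e v v = (μ e)⁻¹ * hitchinForm φ v e := by
  rw [hitchinBilin, LinearMap.compr₂_apply, LinearMap.compl₁₂_apply, hitchinForm,
    wedgeBilin_apply, LinearMap.coe_mk, AddHom.coe_mk, wedgeBilin_apply]

theorem hitchinForm_eq {μ : V [⋀^Fin 7]→ₗ[ℝ] ℝ} {φ : V [⋀^Fin 3]→ₗ[ℝ] ℝ} (hφ : IsPositive μ φ)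
    {e : Fin 7 → V} (he : μ e ≠ 0) (v : V) :
    hitchinForm φ v = hitchinBilin μ φ e v v • μ := by
  have h₁ : hitchinBilin μ φ e v v = (μ e)⁻¹ * hitchinForm φ v e :=
    hitchinBilin_self μ φ e v
  by_cases hv : v = 0
  · subst hv
    have h₂ : hitchinForm φ 0 = 0 := by
      rw [hitchinForm, map_zero, ← wedgeBilin_apply, ← wedgeBilin_apply, map_zero, map_zero,
        LinearMap.zero_apply]
    simp [h₂]
  · obtain ⟨c, _, hc⟩ := hφ v hv
    rw [h₁, hc]
    congr 1
    simp only [AlternatingMap.smul_apply, smul_eq_mul]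
    field_simp

theorem hitchinBilin_pos {μ : V [⋀^Fin 7]→ₗ[ℝ] ℝ} {φ : V [⋀^Fin 3]→ₗ[ℝ] ℝ}
    (hφ : IsPositive μ φ) {e : Fin 7 → V} (he : μ e ≠ 0) {v : V} (hv : v ≠ 0) :
    0 < hitchinBilin μ φ e v v := by
  obtain ⟨c, hc, h⟩ := hφ v hv
  have h₁ : hitchinBilin μ φ e v v = (μ e)⁻¹ * hitchinForm φ v e :=
    hitchinBilin_self μ φ e v
  rw [h₁, h]
  simp only [AlternatingMap.smul_apply, smul_eq_mul]
  field_simp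
  exact hc

/-- A positive `3`-form has an associated metric. -/
theorem exists_isAssociatedMetric (hV : Module.finrank ℝ V = 7) {μ : V [⋀^Fin 7]→ₗ[ℝ] ℝ}
    (hμ : μ ≠ 0) {φ : V [⋀^Fin 3]→ₗ[ℝ] ℝ} (hφ : IsPositive μ φ) :
    ∃ g, IsAssociatedMetric μ φ g := by
  obtain ⟨e₀, he₀⟩ : ∃ e, μ e ≠ 0 := by
    by_contra! h
    exact hμ (AlternatingMap.ext h)
  let B := hitchinBilin μ φ e₀
  let g₀ : LinearMap.BilinForm ℝ V := (1 / 2 : ℝ) • (B + B.flip)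
  have hg₀ : ∀ u v, g₀ u v = (1 / 2 : ℝ) * (B u v + B v u) := fun u v => rfl
  have hsymm : ∀ u v, g₀ u v = g₀ v u := fun u v => by rw [hg₀, hg₀, add_comm]
  have hdiag : ∀ v, g₀ v v = B v v := fun v => by rw [hg₀]; ring
  have hpos : ∀ v, v ≠ 0 → 0 < g₀ v v := fun v hv => by
    rw [hdiag]; exact hitchinBilin_pos hφ he₀ hv
  obtain ⟨e₁, he₁⟩ := exists_isOrthonormalFrame hsymm hpos hV
  have hφ0 : φ ≠ 0 := by
    rintro rfl
    have : Nontrivial V := Module.nontrivial_of_finrank_pos (R := ℝ) (by omega)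
    obtain ⟨v, hv⟩ := exists_ne (0 : V)
    refine hitchinForm_ne_zero hμ hφ hv ?_
    rw [hitchinForm, ← wedgeBilin_apply, map_zero]
  have hn := frameInner_self_pos hV he₁ hφ0
  set n := frameInner e₁ φ φ with hn'
  obtain ⟨t, ht, ht3⟩ : ∃ t : ℝ, 0 < t ∧ t ^ 3 = n / 7 :=
    ⟨(n / 7) ^ ((3 : ℕ) : ℝ)⁻¹, by positivity, Real.rpow_inv_natCast_pow (by positivity) (by simp)⟩
  refine ⟨t • g₀, fun u v => ?_, fun v hv => ?_, ⟨t⁻¹, by positivity, fun v => ?_⟩, fun e he => ?_⟩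
  · simp [hsymm u v]
  · have := hpos v hv
    simp only [LinearMap.smul_apply, smul_eq_mul]
    positivity
  · rw [hitchinForm_eq hφ he₀]
    congr 1
    simp only [LinearMap.smul_apply, smul_eq_mul, hdiag]
    field_simp
    rfl
  · have he' : IsOrthonormalFrame g₀ (fun i => Real.sqrt t • e i) := fun i j => by
      rw [← he i j]
      simp only [map_smul, LinearMap.smul_apply, smul_eq_mul]
      rw [← mul_assoc, Real.mul_self_sqrt ht.le]
    have h₁ := frameInner_eq hsymm hV he₁ he' φ φ
    rw [frameInner_smul, Real.sq_sqrt ht.le, ht3, ← hn'] at h₁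
    have : n ≠ 0 := hn.ne'
    field_simp at h₁
    exact h₁

theorem isAssociatedMetric_metric (hV : Module.finrank ℝ V = 7) {μ : V [⋀^Fin 7]→ₗ[ℝ] ℝ}
    (hμ : μ ≠ 0) {φ : V [⋀^Fin 3]→ₗ[ℝ] ℝ} (hφ : IsPositive μ φ) :
    IsAssociatedMetric μ φ (metric μ φ) :=
  Classical.epsilon_spec (exists_isAssociatedMetric hV hμ hφ)

/-- A hyperplane, given as the image of `D` and contained in the kernel of `l ≠ 0`, has a unit
normal on which `l` is negative, and this normal spans a complement. -/
theorem exists_unit_normal [FiniteDimensional ℝ V] {U : Type*} [AddCommGroup U] [Module ℝ U]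
    [FiniteDimensional ℝ U] {D : U →ₗ[ℝ] V} (hD : Function.Injective D)
    (hdim : Module.finrank ℝ V = Module.finrank ℝ U + 1) {g : LinearMap.BilinForm ℝ V}
    (hpos : ∀ v, v ≠ 0 → 0 < g v v) {l : V →ₗ[ℝ] ℝ} (hl : l ≠ 0) (hlD : l ∘ₗ D = 0) :
    ∃ ν, g ν ν = 1 ∧ (∀ w, g ν (D w) = 0) ∧ l ν < 0 ∧ ∀ v, ∃ (a : ℝ) (u : U), v = a • ν + D u := by
  obtain ⟨ν₀, hν₀, hne⟩ : ∃ ν₀ ∈ LinearMap.ker (g.compl₂ D), ν₀ ≠ 0 := by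
    refine (Submodule.ne_bot_iff _).1 fun h => ?_
    have h₁ := LinearMap.finrank_le_finrank_of_injective (LinearMap.ker_eq_bot.1 h)
    have h₂ : Module.finrank ℝ (U →ₗ[ℝ] ℝ) = Module.finrank ℝ U := Subspace.dual_finrank_eq
    omega
  have horth : ∀ w, g ν₀ (D w) = 0 := fun w => DFunLike.congr_fun (LinearMap.mem_ker.1 hν₀) w
  have hnot : ν₀ ∉ LinearMap.range D := by
    rintro ⟨w, rfl⟩
    exact (hpos _ hne).ne' (horth w)
  have hspan : ∀ v, ∃ (a : ℝ) (u : U), v = a • ν₀ + D u := by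
    have hr : Module.finrank ℝ (LinearMap.range D) = Module.finrank ℝ U :=
      LinearMap.finrank_range_of_inj hD
    have hlt : LinearMap.range D < Submodule.span ℝ {ν₀} ⊔ LinearMap.range D :=
      lt_of_le_of_ne le_sup_right fun h => hnot (h ▸ Submodule.mem_sup_left
        (Submodule.mem_span_singleton_self ν₀))
    have htop : Submodule.span ℝ {ν₀} ⊔ LinearMap.range D = ⊤ := by
      refine Submodule.eq_top_of_finrank_eq (le_antisymm (Submodule.finrank_le _) ?_)
      have := Submodule.finrank_lt_finrank_of_lt hlt
      omega
    intro v
    obtain ⟨y, hy, z, ⟨u, rfl⟩, rfl⟩ := Submodule.mem_sup.1 (htop ▸ Submodule.mem_top (x := v))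
    obtain ⟨a, rfl⟩ := Submodule.mem_span_singleton.1 hy
    exact ⟨a, u, rfl⟩
  have hlν : l ν₀ ≠ 0 := fun h => hl <| by
    ext v
    obtain ⟨a, u, rfl⟩ := hspan v
    have : l (D u) = 0 := DFunLike.congr_fun hlD u
    simp [h, this]
  have hpp := hpos _ hne
  set s := Real.sqrt (g ν₀ ν₀)
  have hs : s ≠ 0 := (Real.sqrt_pos.2 hpp).ne'
  have hs2 : s * s = g ν₀ ν₀ := Real.mul_self_sqrt hpp.le
  have key : ∀ c : ℝ, c * c = (s * s)⁻¹ → c * l ν₀ < 0 →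
      ∃ ν, g ν ν = 1 ∧ (∀ w, g ν (D w) = 0) ∧ l ν < 0 ∧
        ∀ v, ∃ (a : ℝ) (u : U), v = a • ν + D u := by
    intro c hc hcl
    have hc0 : c ≠ 0 := by rintro rfl; simp at hcl
    refine ⟨c • ν₀, ?_, fun w => by simp [horth], by simpa using hcl, fun v => ?_⟩
    · simp only [map_smul, LinearMap.smul_apply, smul_eq_mul]
      rw [← mul_assoc, hc, ← hs2]
      field_simp
    · obtain ⟨a, u, rfl⟩ := hspan v
      exact ⟨a * c⁻¹, u, by rw [smul_smul, mul_assoc, inv_mul_cancel₀ hc0, mul_one]⟩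
  have hspos : 0 < s := Real.sqrt_pos.2 hpp
  rcases lt_or_gt_of_ne hlν with h | h
  · exact key s⁻¹ (by field_simp) (mul_neg_of_pos_of_neg (by positivity) h)
  · refine key (-s⁻¹) (by field_simp) (mul_neg_of_neg_of_pos (by simpa using hspos) h)

end G2Linear

theorem LinearIndependent.exists_continuousLinearMap {W : Type*} [NormedAddCommGroup W]
    [NormedSpace ℝ W] {n : ℕ} {w : Fin n → W} (hw : LinearIndependent ℝ w) :
    ∃ A : W →L[ℝ] (Fin n → ℝ), ∀ i, A (w i) = Pi.single i 1 := by
  let S := Submodule.span ℝ (range w)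
  have : FiniteDimensional ℝ S := FiniteDimensional.span_of_finite ℝ (finite_range w)
  let b := Module.Basis.span hw
  let f : S →L[ℝ] (Fin n → ℝ) := LinearMap.toContinuousLinearMap b.equivFun.toLinearMap
  obtain ⟨g, hg⟩ := f.exist_extension_of_finiteDimensional_range
  refine ⟨g, fun i => ?_⟩
  have h₁ := DFunLike.congr_fun hg (b i)
  have h₂ : ((b i : S) : W) = w i := congrArg Subtype.val (Module.Basis.span_apply hw i)
  have h₃ : f (b i) = Pi.single i 1 := by
    simp [f, Finsupp.single_eq_pi_single]
  rw [← h₂, ← h₃, h₁]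
  rfl

/-- The coefficients of a smooth function with values in the span of a smooth family that is
linearly independent at a point can be chosen smooth near this point. -/
theorem exists_contDiffOn_coefficients {X W : Type*} [NormedAddCommGroup X] [NormedSpace ℝ X]
    [NormedAddCommGroup W] [NormedSpace ℝ W] {n : ℕ} {b : Fin n → X → W} {t : X → W} {Ω : Set X}
    (hΩ : IsOpen Ω) {u₀ : X} (hu₀ : u₀ ∈ Ω) (hb : ∀ i, ContDiffOn ℝ ∞ (b i) Ω)
    (ht : ContDiffOn ℝ ∞ t Ω) (hli : LinearIndependent ℝ fun i => b i u₀)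
    (hspan : ∀ u ∈ Ω, ∃ c : Fin n → ℝ, t u = ∑ i, c i • b i u) :
    ∃ Ω' ⊆ Ω, IsOpen Ω' ∧ u₀ ∈ Ω' ∧ ∃ a : Fin n → X → ℝ, (∀ i, ContDiffOn ℝ ∞ (a i) Ω') ∧
      ∀ u ∈ Ω', t u = ∑ i, a i u • b i u := by
  obtain ⟨A, hA⟩ := hli.exists_continuousLinearMap
  let P : X → (Fin n → ℝ) →L[ℝ] (Fin n → ℝ) := fun u =>
    ∑ i, (ContinuousLinearMap.proj (R := ℝ) (φ := fun _ : Fin n => ℝ) i).smulRight (A (b i u))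
  have hPapp : ∀ u c, P u c = A (∑ i, c i • b i u) := fun u c => by simp [P]
  have hP : ContDiffOn ℝ ∞ P Ω := by
    refine ContDiffOn.sum fun i _ => ?_
    exact ((ContinuousLinearMap.smulRightL ℝ (Fin n → ℝ) (Fin n → ℝ)
      (ContinuousLinearMap.proj i)).contDiff.comp A.contDiff).comp_contDiffOn (hb i)
  have hP₀ : P u₀ = 1 := by
    ext c k
    rw [hPapp, map_sum]
    simp [hA, Pi.single_apply]
  refine ⟨Ω ∩ P ⁻¹' {x | IsUnit x}, inter_subset_left,
    hP.continuousOn.isOpen_inter_preimage hΩ Units.isOpen, ⟨hu₀, by simp [hP₀]⟩,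
    fun i u => Ring.inverse (P u) (A (t u)) i, fun i u hu => ?_, fun u hu => ?_⟩
  · have hx := hΩ.mem_nhds hu.1
    obtain ⟨x, hx'⟩ : IsUnit (P u) := hu.2
    have h₁ : ContDiffAt ℝ ∞ (fun u => Ring.inverse (P u)) u :=
      ContDiffAt.comp u (g := Ring.inverse) (hx' ▸ contDiffAt_ringInverse ℝ x)
        ((hP u hu.1).contDiffAt hx)
    have h₂ : ContDiffAt ℝ ∞ (fun u => A (t u)) u :=
      A.contDiff.contDiffAt.comp u ((ht u hu.1).contDiffAt hx)
    exact (contDiffAt_pi.1 (h₁.clm_apply h₂) i).contDiffWithinAt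
  · obtain ⟨c, hc⟩ := hspan u hu.1
    have : Ring.inverse (P u) (A (t u)) = c := by
      rw [hc, ← hPapp, ← mul_apply_eq_comp, Ring.inverse_mul_cancel _ hu.2]
      rfl
    simp only [this]
    exact hc

namespace Forms
open Topology Filter

section Embedding

variable {E : Type*} [NormedAddCommGroup E] [NormedSpace ℝ E]
  {H : Type*} [TopologicalSpace H] {I : ModelWithCorners ℝ E H}
  {M : Type*} [TopologicalSpace M] [ChartedSpace H M]
  {E' : Type*} [NormedAddCommGroup E'] [NormedSpace ℝ E']
  {H' : Type*} [TopologicalSpace H'] {I' : ModelWithCorners ℝ E' H'}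
  {N : Type*} [TopologicalSpace N] [ChartedSpace H' N]

/-- A smooth embedding of a manifold without boundary has local smooth retractions. -/
theorem exists_local_retraction [I'.Boundaryless] {j : N → M}
    (hj : Manifold.IsSmoothEmbedding I' I ∞ j) {q₀ : N} {O : Set N} (hO : IsOpen O)
    (hq₀ : q₀ ∈ O) :
    ∃ U, IsOpen U ∧ j q₀ ∈ U ∧ ∃ r : M → N, ContMDiffOn I I' ∞ r U ∧ MapsTo r U O ∧
      ∀ q, j q ∈ U → r (j q) = q := by
  have h := hj.isImmersion.isImmersionAt q₀
  let π : M → E' := fun x => (h.equiv.symm (h.codChart.extend I x)).1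
  have hπ : ContMDiffOn I 𝓘(ℝ, E') ∞ π h.codChart.source :=
    ((ContinuousLinearMap.fst ℝ E' h.complement).comp
      (h.equiv.symm : E →L[ℝ] E' × h.complement)).contMDiff.comp_contMDiffOn
      (OpenPartialHomeomorph.contMDiffOn_extend h.codChart_mem_maximalAtlas)
  let T : Set E' := (h.domChart.extend I').target ∩ (h.domChart.extend I').symm ⁻¹' O
  have hT : IsOpen T := h.domChart.continuousOn_extend_symm.isOpen_inter_preimage
    h.domChart.isOpen_extend_target hO
  obtain ⟨W, hW, hjW⟩ := hj.isEmbedding.isOpen_iff.1 h.domChart.open_source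
  have hπj : ∀ q ∈ h.domChart.source, π (j q) = h.domChart.extend I' q := fun q hq => by
    have hq' : q ∈ (h.domChart.extend I').source := by simpa using hq
    have := h.writtenInCharts ((h.domChart.extend I').map_source hq')
    simp only [Function.comp_apply, (h.domChart.extend I').left_inv hq'] at this
    change (h.equiv.symm (h.codChart.extend I (j q))).1 = _
    rw [this, h.equiv.symm_apply_apply]
  have hmem : ∀ q ∈ h.domChart.source, q ∈ O → π (j q) ∈ T := fun q hq hqO => by
    have hq' : q ∈ (h.domChart.extend I').source := by simpa using hq
    rw [hπj q hq]
    refine ⟨(h.domChart.extend I').map_source hq', ?_⟩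
    rw [mem_preimage, (h.domChart.extend I').left_inv hq']
    exact hqO
  have hd₀ := h.mem_domChart_source
  refine ⟨(h.codChart.source ∩ π ⁻¹' T) ∩ W,
    (hπ.continuousOn.isOpen_inter_preimage h.codChart.open_source hT).inter hW,
    ⟨⟨h.mem_codChart_source, hmem q₀ hd₀ hq₀⟩, ?_⟩, (h.domChart.extend I').symm ∘ π, ?_,
    fun x hx => hx.1.2.2, fun q hq => ?_⟩
  · rw [← mem_preimage, hjW]; exact hd₀
  · refine ContMDiffOn.comp
      (contMDiffOn_extend_symm h.domChart_mem_maximalAtlas)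
      (hπ.mono fun x hx => hx.1.1) fun x hx => ?_
    have := hx.1.2.1
    rwa [OpenPartialHomeomorph.extend_target'] at this
  · have hqs : q ∈ h.domChart.source := by rw [← hjW]; exact hq.2
    rw [Function.comp_apply, hπj q hqs]
    exact (h.domChart.extend I').left_inv (by simpa using hqs)

theorem injective_mfderiv_of_isSmoothEmbedding [I'.Boundaryless] [IsManifold I' ∞ N]
    {j : N → M} (hj : Manifold.IsSmoothEmbedding I' I ∞ j) (q : N) :
    Function.Injective (mfderiv I' I j q) := by
  obtain ⟨U, hU, hqU, r, hr, -, hrj⟩ := exists_local_retraction hj (q₀ := q) isOpen_univ trivial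
  have hjq : MDifferentiableAt I' I j q := (hj.contMDiff q).mdifferentiableAt (by simp)
  have hrq : MDifferentiableAt I I' r (j q) :=
    ((hr _ hqU).contMDiffAt (hU.mem_nhds hqU)).mdifferentiableAt (by simp)
  have hev : r ∘ j =ᶠ[𝓝 q] id := by
    filter_upwards [hjq.continuousAt.preimage_mem_nhds (hU.mem_nhds hqU)] with q' hq'
    exact hrj q' hq'
  have h₁ := hev.mfderiv_eq (I := I') (I' := I')
  rw [mfderiv_comp q hrq hjq, mfderiv_id] at h₁
  intro v w hvw
  have hv := DFunLike.congr_fun h₁ v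
  have hw := DFunLike.congr_fun h₁ w
  have : (mfderiv I I' r (j q)) (mfderiv I' I j q v) = mfderiv I I' r (j q) (mfderiv I' I j q w) :=
    congrArg _ hvw
  exact hv.symm.trans (this.trans hw)

end Embedding

/-- The differential of a map into the boundary of a manifold modelled on the half-space takes
values in the kernel of the coordinate that defines the boundary. -/
theorem mfderiv_extChartAt_mfderiv_apply_zero {n : ℕ} [NeZero n]
    {M : Type*} [TopologicalSpace M] [ChartedSpace (EuclideanHalfSpace n) M]
    [IsManifold (𝓡∂ n) ∞ M]
    {E' : Type*} [NormedAddCommGroup E'] [NormedSpace ℝ E']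
    {H' : Type*} [TopologicalSpace H'] {I' : ModelWithCorners ℝ E' H'} [I'.Boundaryless]
    {N : Type*} [TopologicalSpace N] [ChartedSpace H' N] {j : N → M} {q : N}
    (hj : MDifferentiableAt I' (𝓡∂ n) j q) (hq : j q ∈ (𝓡∂ n).boundary M)
    (w : TangentSpace I' q) :
    EuclideanSpace.proj (𝕜 := ℝ) (0 : Fin n)
      (mfderiv (𝓡∂ n) 𝓘(ℝ, EuclideanSpace ℝ (Fin n)) (extChartAt (𝓡∂ n) (j q)) (j q)
        (mfderiv I' (𝓡∂ n) j q w)) = 0 := by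
  let π := EuclideanSpace.proj (𝕜 := ℝ) (0 : Fin n)
  let c := extChartAt (𝓡∂ n) (j q)
  have hc : MDifferentiableAt (𝓡∂ n) 𝓘(ℝ, EuclideanSpace ℝ (Fin n)) c (j q) :=
    mdifferentiableAt_extChartAt (by simp)
  have hπ : MDifferentiableAt 𝓘(ℝ, EuclideanSpace ℝ (Fin n)) 𝓘(ℝ, ℝ) π (c (j q)) :=
    π.differentiableAt.mdifferentiableAt
  have hmin : ∀ q', π (c (j q)) ≤ π (c (j q')) := fun q' => by
    have h₁ : c (j q) ∈ frontier (range (𝓡∂ n)) := hq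
    rw [frontier_range_modelWithCornersEuclideanHalfSpace] at h₁
    have h₂ : c (j q') ∈ range (𝓡∂ n) := mem_range_self _
    rw [range_modelWithCornersEuclideanHalfSpace] at h₂
    have h₃ : c (j q) 0 = 0 := Eq.symm h₁
    change c (j q) 0 ≤ c (j q') 0
    rw [h₃]
    exact h₂
  have hd : mfderiv I' 𝓘(ℝ, ℝ) (π ∘ c ∘ j) q = 0 := by
    have hh : MDifferentiableAt I' 𝓘(ℝ, ℝ) (π ∘ c ∘ j) q :=
      hπ.comp q (hc.comp q hj)
    rw [hh.mfderiv, I'.range_eq_univ, fderivWithin_univ]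
    refine IsLocalMin.fderiv_eq_zero (Filter.Eventually.of_forall fun u => ?_)
    change π (c (j ((extChartAt I' q).symm (extChartAt I' q q)))) ≤
      π (c (j ((extChartAt I' q).symm u)))
    rw [(extChartAt I' q).left_inv (mem_extChartAt_source q)]
    exact hmin _
  rw [mfderiv_comp q hπ (hc.comp q hj), mfderiv_comp q hc hj, mfderiv_eq_fderiv,
    π.fderiv] at hd
  exact DFunLike.congr_fun hd w

end Forms

namespace Forms
open Topology Filter

section Extension

variable {E : Type*} [NormedAddCommGroup E] [NormedSpace ℝ E]
  {H : Type*} [TopologicalSpace H] {I : ModelWithCorners ℝ E H}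
  {M : Type*} [TopologicalSpace M] [ChartedSpace H M] [IsManifold I ∞ M]
  {E' : Type*} [NormedAddCommGroup E'] [NormedSpace ℝ E']
  {H' : Type*} [TopologicalSpace H'] {I' : ModelWithCorners ℝ E' H'}
  {N : Type*} [TopologicalSpace N] [ChartedSpace H' N] [IsManifold I' ∞ N]
  {k : ℕ}

/-- Local extensions of a form on a compact submanifold, with values in given subspaces, can be
glued by a partition of unity. -/
theorem exists_smooth_extension_of_local [FiniteDimensional ℝ E] [T2Space M] [CompactSpace M]
    {j : N → M} (hc : IsClosed (range j))
    (S : (x : M) → Submodule ℝ (TangentSpace I x [⋀^Fin k]→L[ℝ] ℝ)) (θ : FormField I' N k)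
    (hloc : ∀ q₀, ∃ U, IsOpen U ∧ j q₀ ∈ U ∧ ∃ α : FormField I M k, (∀ x ∈ U, SmoothAt I α x) ∧
      (∀ x ∈ U, α x ∈ S x) ∧ ∀ q, j q ∈ U → restrict I I' j k α q = θ q) :
    ∃ α : Smooth I M k, (∀ x, α.1 x ∈ S x) ∧ restrict I I' j k α.1 = θ := by
  choose U hU hjU α hα hαS hαθ using hloc
  obtain ⟨t, ht⟩ := hc.isCompact.elim_finite_subcover U hU
    (by rintro _ ⟨q, rfl⟩; exact mem_iUnion.2 ⟨q, hjU q⟩)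
  obtain ⟨f, hf⟩ := SmoothPartitionOfUnity.exists_isSubordinate I hc (fun i : t => U i)
    (fun i => hU i) (by simpa [iUnion_subtype] using ht)
  have hsub : ∀ (i : t) x, f i x ≠ 0 → x ∈ U i := fun i x hx =>
    hf i (subset_tsupport _ hx)
  refine ⟨⟨∑ i : t, funSmul (f i) (α i), mem_smooth_iff.2 fun x => SmoothAt.sum fun i _ => ?_⟩,
    fun x => ?_, ?_⟩
  · by_cases hx : x ∈ tsupport (f i)
    · exact SmoothAt.funSmul (f i).contMDiff.contMDiffAt (hα i x (hf i hx))
    · have h0 : SmoothAt I (0 : FormField I M k) x := mem_smooth_iff.1 (zero_mem _) x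
      refine h0.congr_of_eventuallyEq ?_
      filter_upwards [(isClosed_tsupport (f i)).isOpen_compl.mem_nhds hx] with y hy
      have : f i y = 0 := by
        by_contra h
        exact hy (subset_tsupport _ h)
      rw [funSmul, this, zero_smul]; rfl
  · change (∑ i : t, funSmul (f i) (α i)) x ∈ S x
    rw [sum_formField_apply]
    refine Submodule.sum_mem _ fun i _ => ?_
    by_cases h : f i x = 0
    · rw [funSmul, h, zero_smul]; exact zero_mem _
    · exact Submodule.smul_mem _ _ (hαS i x (hsub i x h))
  · change restrict I I' j k (∑ i : t, funSmul (f i) (α i)) = θ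
    rw [map_sum]
    funext q
    rw [sum_formField_apply]
    have h₁ : ∀ i : t, restrict I I' j k (funSmul (f i) (α i)) q = f i (j q) • θ q := fun i => by
      have : restrict I I' j k (funSmul (f i) (α i)) q = f i (j q) • restrict I I' j k (α i) q :=
        rfl
      rw [this]
      by_cases h : f i (j q) = 0
      · rw [h, zero_smul, zero_smul]
      · rw [hαθ i q (hsub i _ h)]
    simp_rw [h₁]
    rw [← Finset.sum_smul, ← finsum_eq_sum_of_fintype, f.sum_eq_one (mem_range_self q), one_smul]

theorem exists_smooth_extension [FiniteDimensional ℝ E] [T2Space M] [CompactSpace M]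
    [I'.Boundaryless]
    {j : N → M} (hj : Manifold.IsSmoothEmbedding I' I ∞ j) (hc : IsClosed (range j))
    (η : Smooth I' N k) : ∃ α : Smooth I M k, restrict I I' j k α.1 = η.1 := by
  obtain ⟨α, -, hα⟩ := exists_smooth_extension_of_local hc (fun _ => ⊤) η.1 fun q₀ => by
    obtain ⟨U, hU, hqU, r, hr, -, hrj⟩ := exists_local_retraction hj (q₀ := q₀) isOpen_univ trivial
    refine ⟨U, hU, hqU, restrict I' I r k η.1, fun x hx => ?_, fun _ _ => trivial, fun q hq => ?_⟩
    · refine SmoothAt.restrict (mem_smooth_iff.1 η.2 _) ?_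
      filter_upwards [hU.mem_nhds hx] with x' hx'
      exact (hr x' hx').contMDiffAt (hU.mem_nhds hx')
    · refine restrict_restrict_of_eventuallyEq ((hj.contMDiff q).mdifferentiableAt (by simp))
        (((hr _ hq).contMDiffAt (hU.mem_nhds hq)).mdifferentiableAt (by simp)) ?_ _
      filter_upwards [hj.contMDiff.continuous.continuousAt.preimage_mem_nhds (hU.mem_nhds hq)]
        with q' hq'
      exact hrj q' hq'
  exact ⟨α, hα⟩

/-- The contraction of a form on a tangent space with a tangent vector. -/
def contract {x : M} (σ : TangentSpace I x [⋀^Fin (k + 1)]→L[ℝ] ℝ) :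
    TangentSpace I x →ₗ[ℝ] TangentSpace I x [⋀^Fin k]→L[ℝ] ℝ :=
  (ContinuousAlternatingMap.curryLeft (E := E) σ).toLinearMap

variable (I) in
/-- The contraction of a form with the coordinate vector field `e` of the chart at `x₀`. -/
def contractChart (x₀ : M) (σ : FormField I M (k + 1)) : E →ₗ[ℝ] FormField I M k where
  toFun e := fun x => contract (σ x)
    (mfderivWithin 𝓘(ℝ, E) I (extChartAt I x₀).symm (range I) (extChartAt I x₀ x) e)
  map_add' a b := by
    funext x
    have := (mfderivWithin 𝓘(ℝ, E) I (extChartAt I x₀).symm (range I) (extChartAt I x₀ x)).map_add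
      a b
    exact (congrArg (contract (σ x)) this).trans (map_add _ _ _)
  map_smul' c a := by
    funext x
    have := (mfderivWithin 𝓘(ℝ, E) I (extChartAt I x₀).symm (range I) (extChartAt I x₀ x)).map_smul
      c a
    exact (congrArg (contract (σ x)) this).trans (map_smul _ _ _)

variable (I M k) in
/-- The expression of forms in a chart, as a linear map. -/
def inChartLinear (x₀ : M) (y : E) : FormField I M k →ₗ[ℝ] E [⋀^Fin k]→L[ℝ] ℝ where
  toFun σ := inChart I σ x₀ y
  map_add' _ _ := rfl
  map_smul' _ _ := rfl

theorem inChart_contractChart (σ : FormField I M (k + 1)) {x₀ : M} {y : E}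
    (hy : y ∈ (extChartAt I x₀).target) (e : E) :
    inChart I (contractChart I x₀ σ e) x₀ y = (inChart I σ x₀ y).curryLeft e := by
  have h : contractChart I x₀ σ e ((extChartAt I x₀).symm y) =
      contract (σ ((extChartAt I x₀).symm y))
        (mfderivWithin 𝓘(ℝ, E) I (extChartAt I x₀).symm (range I) y e) := by
    change contract (σ ((extChartAt I x₀).symm y)) (mfderivWithin 𝓘(ℝ, E) I (extChartAt I x₀).symm
      (range I) (extChartAt I x₀ ((extChartAt I x₀).symm y)) e) = _
    rw [(extChartAt I x₀).right_inv hy]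
  rw [inChart, h, inChart]
  exact (ContinuousAlternatingMap.curryLeft_compContinuousLinearMap (E := E) (F := E) _ _ _).symm

theorem SmoothAt.contractChart {σ : FormField I M (k + 1)} {x₀ x : M}
    (hx : x ∈ (extChartAt I x₀).source) (hσ : SmoothAt I σ x) (e : E) :
    SmoothAt I (contractChart I x₀ σ e) x := by
  rw [smoothAt_iff hx] at hσ ⊢
  have h₁ : ContDiffWithinAt ℝ ∞ (fun y => (inChart I σ x₀ y).curryLeft e) (range I)
      (extChartAt I x₀ x) :=
    ((ContinuousAlternatingMap.curryLeftLI (𝕜 := ℝ) (E := E) (F := ℝ)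
      (n := k)).contDiff.contDiffAt.comp_contDiffWithinAt _ hσ).clm_apply contDiffWithinAt_const
  refine h₁.congr_of_eventuallyEq_of_mem ?_ (mem_range_self _)
  filter_upwards [extChartAt_target_mem_nhdsWithin' hx] with y hy
  exact inChart_contractChart σ hy e

/-- A form on a compact submanifold that is at each point the restriction of a contraction
`i_v φ` extends to such a form on the whole manifold, if the restriction of `i_v φ` determines
`v`. -/
theorem exists_contraction_extension [FiniteDimensional ℝ E] [T2Space M] [CompactSpace M]
    [I'.Boundaryless]
    {j : N → M} (hj : Manifold.IsSmoothEmbedding I' I ∞ j) (hc : IsClosed (range j))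
    (φ : Smooth I M (k + 1))
    (hinj : ∀ (q : N) (v : TangentSpace I (j q)),
      (contract (φ.1 (j q)) v).compContinuousLinearMap (mfderiv I' I j q) = 0 → v = 0)
    (θ : Smooth I' N k)
    (hθ : ∀ q, ∃ v : TangentSpace I (j q),
      θ.1 q = (contract (φ.1 (j q)) v).compContinuousLinearMap (mfderiv I' I j q)) :
    ∃ α : Smooth I M k, (∀ x, ∃ v, α.1 x = contract (φ.1 x) v) ∧ restrict I I' j k α.1 = θ.1 := by
  have hφ := mem_smooth_iff.1 φ.2
  obtain ⟨α, hα, hαθ⟩ := exists_smooth_extension_of_local hc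
    (fun x => LinearMap.range (contract (φ.1 x))) θ.1 fun q₀ => by
    let c := extChartAt I (j q₀)
    let c' := extChartAt I' q₀
    let e := Module.finBasis ℝ E
    have hjc : Continuous j := hj.contMDiff.continuous
    let β := contractChart I (j q₀) φ.1
    have hβ : ∀ e x, x ∈ c.source → SmoothAt I (β e) x := fun e x hx => (hφ x).contractChart hx e
    -- the forms `i_e φ` in the chart of `N`, as a linear function of `e`
    let Φ : E' → E →ₗ[ℝ] E' [⋀^Fin k]→L[ℝ] ℝ := fun u =>
      inChartLinear I' N k q₀ u ∘ₗ restrict I I' j k ∘ₗ β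
    let Ω : Set E' := c'.target ∩ c'.symm ⁻¹' (j ⁻¹' c.source)
    have hΩ : IsOpen Ω := (continuousOn_extChartAt_symm q₀).isOpen_inter_preimage
      (isOpen_extChartAt_target q₀) ((isOpen_extChartAt_source (j q₀)).preimage hjc)
    have hq₀ : c'.symm (c' q₀) = q₀ := c'.left_inv (mem_extChartAt_source q₀)
    have hu₀ : c' q₀ ∈ Ω := ⟨mem_extChartAt_target q₀, by
      rw [mem_preimage, hq₀]; exact mem_extChartAt_source (j q₀)⟩
    have hsm : ∀ {τ : FormField I' N k} {u}, u ∈ c'.target → SmoothAt I' τ (c'.symm u) →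
        ContDiffWithinAt ℝ ∞ (inChart I' τ q₀) Ω u := fun {τ u} hu h => by
      rw [smoothAt_iff (c'.map_target hu), c'.right_inv hu] at h
      exact h.mono (by rw [I'.range_eq_univ]; exact subset_univ _)
    have hcomp : ∀ (τ : FormField I' N k) q, q ∈ c'.source →
        (inChart I' τ q₀ (c' q)).compContinuousLinearMap (mfderiv I' 𝓘(ℝ, E') c' q) = τ q :=
      fun τ q hq => inChart_compContinuousLinearMap I' τ hq
    obtain ⟨Ω', hΩ'Ω, hΩ', hu₀', a, ha, hat⟩ := exists_contDiffOn_coefficients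
      (b := fun i u => Φ u (e i)) (t := inChart I' θ.1 q₀) hΩ hu₀
      (fun i u hu => hsm hu.1 ((hβ _ _ hu.2).restrict (Eventually.of_forall hj.contMDiff)))
      (fun u hu => hsm hu.1 (mem_smooth_iff.1 θ.2 _))
      (by
        refine e.linearIndependent.map' (Φ (c' q₀)) (LinearMap.ker_eq_bot'.2 fun w hw => ?_)
        have h₁ : restrict I I' j k (β w) q₀ = 0 := by
          refine (hcomp (restrict I I' j k (β w)) q₀ (mem_extChartAt_source q₀)).symm.trans ?_
          exact congrArg (fun τ : E' [⋀^Fin k]→L[ℝ] ℝ =>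
            τ.compContinuousLinearMap (mfderiv I' 𝓘(ℝ, E') c' q₀ : E' →L[ℝ] E')) hw
        have h₂ := hinj q₀ _ h₁
        have h₃ := mfderiv_extChartAt_comp_mfderivWithin_extChartAt_symm'
          (I := I) (mem_extChartAt_source (I := I) (j q₀))
        have h₄ := DFunLike.congr_fun h₃ w
        exact h₄.symm.trans ((congrArg
          (mfderiv I 𝓘(ℝ, E) (extChartAt I (j q₀)) (j q₀)) h₂).trans
          (ContinuousLinearMap.map_zero _)))
      (fun u hu => by
        obtain ⟨v, hv⟩ := hθ (c'.symm u)
        let w : E := mfderiv I 𝓘(ℝ, E) c (j (c'.symm u)) v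
        have h₁ : mfderivWithin 𝓘(ℝ, E) I c.symm (range I) (c (j (c'.symm u))) w = v :=
          DFunLike.congr_fun (mfderivWithin_extChartAt_symm_comp_mfderiv_extChartAt' hu.2) v
        have h₂ : θ.1 (c'.symm u) = restrict I I' j k (β w) (c'.symm u) := by
          rw [hv, ← h₁]; rfl
        refine ⟨fun i => e.repr w i, ?_⟩
        have h₃ : inChart I' θ.1 q₀ u = Φ u w := by
          rw [inChart]
          exact congrArg (fun τ : E' [⋀^Fin k]→L[ℝ] ℝ => τ.compContinuousLinearMap
            (mfderivWithin 𝓘(ℝ, E') I' c'.symm (range I') u : E' →L[ℝ] E')) h₂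
        rw [h₃]
        conv_lhs => rw [← e.sum_repr w]
        rw [map_sum]
        simp_rw [map_smul])
    have hO : IsOpen (c'.source ∩ c' ⁻¹' Ω') :=
      (continuousOn_extChartAt q₀).isOpen_inter_preimage (isOpen_extChartAt_source q₀) hΩ'
    obtain ⟨U, hU, hqU, r, hr, hrO, hrj⟩ :=
      exists_local_retraction hj hO ⟨mem_extChartAt_source q₀, hu₀'⟩
    refine ⟨U ∩ c.source, hU.inter (isOpen_extChartAt_source _),
      ⟨hqU, mem_extChartAt_source _⟩, ∑ i, funSmul (fun x => a i (c' (r x))) (β (e i)),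
      fun x hx => SmoothAt.sum fun i _ => ?_, fun x hx => ?_, fun q hq => ?_⟩
    · have hrx := hrO hx.1
      refine SmoothAt.funSmul ?_ (hβ _ _ hx.2)
      have h₁ : ContMDiffAt 𝓘(ℝ, E') 𝓘(ℝ, ℝ) ∞ (a i) (c' (r x)) :=
        ((ha i _ hrx.2).contDiffAt (hΩ'.mem_nhds hrx.2)).contMDiffAt
      have h₂ : ContMDiffAt I' 𝓘(ℝ, E') ∞ c' (r x) :=
        contMDiffAt_extChartAt' (by simpa [c'] using hrx.1)
      exact h₁.comp x (h₂.comp x ((hr x hx.1).contMDiffAt (hU.mem_nhds hx.1)))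
    · rw [sum_formField_apply]
      exact Submodule.sum_mem _ fun i _ => Submodule.smul_mem _ _ ⟨_, rfl⟩
    · have hrq := hrj q hq.1
      have hqO : q ∈ c'.source ∩ c' ⁻¹' Ω' := by
        have := hrO hq.1
        rwa [hrq] at this
      rw [map_sum, sum_formField_apply]
      have h₁ : ∀ i, restrict I I' j k (funSmul (fun x => a i (c' (r x))) (β (e i))) q =
          a i (c' q) • restrict I I' j k (β (e i)) q := fun i => by
        have : restrict I I' j k (funSmul (fun x => a i (c' (r x))) (β (e i))) q =
          a i (c' (r (j q))) • restrict I I' j k (β (e i)) q := rfl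
        rw [this, hrq]
      simp_rw [h₁]
      have h₂ : inChart I' (∑ i, a i (c' q) • restrict I I' j k (β (e i))) q₀ (c' q) =
          inChart I' θ.1 q₀ (c' q) := by
        rw [hat _ hqO.2]
        exact (map_sum (inChartLinear I' N k q₀ (c' q)) _ _).trans
          (Finset.sum_congr rfl fun i _ => map_smul _ _ _)
      have h₃ := hcomp (∑ i, a i (c' q) • restrict I I' j k (β (e i))) q hqO.1
      rw [h₂, hcomp _ q hqO.1, sum_formField_apply] at h₃
      exact h₃.symm
  refine ⟨α, fun x => ?_, hαθ⟩
  obtain ⟨v, hv⟩ := hα x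
  exact ⟨v, hv.symm⟩

end Extension
end Forms

namespace G2Boundary
open Forms G2Linear

variable {M : Type*} [TopologicalSpace M] [ChartedSpace (EuclideanHalfSpace 7) M]
  [IsManifold (𝓡∂ 7) ∞ M]
  {N : Type*} [TopologicalSpace N] [ChartedSpace (EuclideanSpace ℝ (Fin 6)) N]
  [IsManifold (𝓡 6) ∞ N]
  {j : N → M} {μ : Smooth (𝓡∂ 7) M 7} {φ : Smooth (𝓡∂ 7) M 3}

instance (x : M) : FiniteDimensional ℝ (TangentSpace (𝓡∂ 7) x) :=
  inferInstanceAs (FiniteDimensional ℝ (EuclideanSpace ℝ (Fin 7)))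

instance (q : N) : FiniteDimensional ℝ (TangentSpace (𝓡 6) q) :=
  inferInstanceAs (FiniteDimensional ℝ (EuclideanSpace ℝ (Fin 6)))

theorem finrank_tangentSpace (x : M) : Module.finrank ℝ (TangentSpace (𝓡∂ 7) x) = 7 :=
  finrank_euclideanSpace_fin (𝕜 := ℝ) (n := 7)

theorem finrank_tangentSpace_boundary (q : N) : Module.finrank ℝ (TangentSpace (𝓡 6) q) = 6 :=
  finrank_euclideanSpace_fin (𝕜 := ℝ) (n := 6)

theorem finrank_tangentSpace_eq_add_one (x : M) (q : N) :
    Module.finrank ℝ (TangentSpace (𝓡∂ 7) x) = Module.finrank ℝ (TangentSpace (𝓡 6) q) + 1 := by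
  rw [finrank_tangentSpace, finrank_tangentSpace_boundary]

theorem toAlternatingMap_ne_zero (hμ : ∀ x, μ.1 x ≠ 0) (x : M) :
    (μ.1 x).toAlternatingMap ≠ 0 := fun h =>
  hμ x (ContinuousAlternatingMap.ext fun v => DFunLike.congr_fun h v)

/-- The restriction of `i_v φ` to the boundary determines `v`. -/
theorem eq_zero_of_contract_comp_mfderiv_eq_zero
    (hj : Manifold.IsSmoothEmbedding (𝓡 6) (𝓡∂ 7) ∞ j) (hμ : ∀ x, μ.1 x ≠ 0)
    (hφ : ∀ x, IsPositive (μ.1 x).toAlternatingMap (φ.1 x).toAlternatingMap) (q : N)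
    (v : TangentSpace (𝓡∂ 7) (j q))
    (hv : (contract (φ.1 (j q)) v).compContinuousLinearMap (mfderiv (𝓡 6) (𝓡∂ 7) j q) = 0) :
    v = 0 := by
  refine eq_zero_of_curryLeft_compLinearMap_eq_zero (D := (mfderiv (𝓡 6) (𝓡∂ 7) j q).toLinearMap)
    (injective_mfderiv_of_isSmoothEmbedding hj q) (finrank_tangentSpace_eq_add_one _ q)
    (toAlternatingMap_ne_zero hμ (j q)) (hφ (j q)) ?_
  ext w
  exact DFunLike.congr_fun hv w

/-- At a boundary point there is an outward unit normal, which spans a complement of the tangent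
space of the boundary. -/
theorem exists_isOutwardNormal
    (hj : Manifold.IsSmoothEmbedding (𝓡 6) (𝓡∂ 7) ∞ j)
    (hrange : range j = (𝓡∂ 7).boundary M) (hμ : ∀ x, μ.1 x ≠ 0)
    (hφ : ∀ x, IsPositive (μ.1 x).toAlternatingMap (φ.1 x).toAlternatingMap) (q : N) :
    ∃ ν, IsOutwardNormal μ φ j q ν ∧ ∀ v : TangentSpace (𝓡∂ 7) (j q),
      ∃ (a : ℝ) (u : TangentSpace (𝓡 6) q), v = a • ν + mfderiv (𝓡 6) (𝓡∂ 7) j q u := by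
  have hg := isAssociatedMetric_metric (finrank_tangentSpace (j q))
    (toAlternatingMap_ne_zero hμ (j q)) (hφ (j q))
  let l : TangentSpace (𝓡∂ 7) (j q) →ₗ[ℝ] ℝ :=
    (EuclideanSpace.proj (𝕜 := ℝ) (0 : Fin 7)).toLinearMap ∘ₗ
      (mfderiv (𝓡∂ 7) 𝓘(ℝ, EuclideanSpace ℝ (Fin 7)) (extChartAt (𝓡∂ 7) (j q)) (j q)).toLinearMap
  have hl : l ≠ 0 := by
    intro h
    have h₁ := mfderiv_extChartAt_comp_mfderivWithin_extChartAt_symm'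
      (I := 𝓡∂ 7) (mem_extChartAt_source (I := 𝓡∂ 7) (j q))
    have h₂ := DFunLike.congr_fun h₁ (EuclideanSpace.single (0 : Fin 7) (1 : ℝ))
    have h₃ := DFunLike.congr_fun h (mfderivWithin 𝓘(ℝ, EuclideanSpace ℝ (Fin 7)) (𝓡∂ 7)
      (extChartAt (𝓡∂ 7) (j q)).symm (range (𝓡∂ 7)) (extChartAt (𝓡∂ 7) (j q) (j q))
      (EuclideanSpace.single (0 : Fin 7) (1 : ℝ)))
    have h₄ := (congrArg (EuclideanSpace.proj (𝕜 := ℝ) (0 : Fin 7)) h₂).symm.trans h₃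
    have h₅ : EuclideanSpace.proj (𝕜 := ℝ) (0 : Fin 7) (EuclideanSpace.single (0 : Fin 7) (1 : ℝ))
      = 0 := h₄
    simp at h₅
  obtain ⟨ν, h₁, h₂, h₃, h₄⟩ := exists_unit_normal
    (D := (mfderiv (𝓡 6) (𝓡∂ 7) j q).toLinearMap)
    (injective_mfderiv_of_isSmoothEmbedding hj q) (finrank_tangentSpace_eq_add_one _ q)
    hg.pos hl (by
      ext w
      exact mfderiv_extChartAt_mfderiv_apply_zero ((hj.contMDiff q).mdifferentiableAt (by simp))
        (hrange ▸ mem_range_self q) w)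
  exact ⟨ν, ⟨h₁, h₂, h₃⟩, h₄⟩

theorem restrict_mem_omega7Bdry
    (hj : Manifold.IsSmoothEmbedding (𝓡 6) (𝓡∂ 7) ∞ j)
    (hrange : range j = (𝓡∂ 7).boundary M) (hμ : ∀ x, μ.1 x ≠ 0)
    (hφ : ∀ x, IsPositive (μ.1 x).toAlternatingMap (φ.1 x).toAlternatingMap)
    {α : Smooth (𝓡∂ 7) M 2} (hα : α ∈ Omega7 φ) :
    (⟨restrict (𝓡∂ 7) (𝓡 6) j 2 α.1, restrict_mem_smooth α.2 hj.contMDiff⟩ : Smooth (𝓡 6) N 2) ∈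
      Omega7Bdry μ φ j := by
  intro q
  obtain ⟨ν, hν, hspan⟩ := exists_isOutwardNormal hj hrange hμ hφ q
  obtain ⟨v, hv⟩ := hα (j q)
  obtain ⟨a, u, rfl⟩ := hspan v
  refine Submodule.mem_sup.2 ⟨a • (((φ.1 (j q)).toAlternatingMap.curryLeft ν).compLinearMap
    (mfderiv (𝓡 6) (𝓡∂ 7) j q).toLinearMap), Submodule.smul_mem _ _
      (Submodule.subset_span ⟨ν, hν, rfl⟩), _, ⟨u, rfl⟩, ?_⟩
  have h₁ : (restrict (𝓡∂ 7) (𝓡 6) j 2 α.1 q).toAlternatingMap =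
      (α.1 (j q)).toAlternatingMap.compLinearMap (mfderiv (𝓡 6) (𝓡∂ 7) j q).toLinearMap := rfl
  rw [h₁, hv, map_add, map_smul]
  have h₂ : (restrict (𝓡∂ 7) (𝓡 6) j 3 φ.1 q).toAlternatingMap =
      (φ.1 (j q)).toAlternatingMap.compLinearMap (mfderiv (𝓡 6) (𝓡∂ 7) j q).toLinearMap := rfl
  rw [h₂, AlternatingMap.curryLeft_compLinearMap]
  rfl

theorem exists_contract_of_mem_omega7Bdry {θ : Smooth (𝓡 6) N 2} (hθ : θ ∈ Omega7Bdry μ φ j)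
    (q : N) : ∃ v : TangentSpace (𝓡∂ 7) (j q),
      θ.1 q = (contract (φ.1 (j q)) v).compContinuousLinearMap (mfderiv (𝓡 6) (𝓡∂ 7) j q) := by
  let L : TangentSpace (𝓡∂ 7) (j q) →ₗ[ℝ] TangentSpace (𝓡 6) q [⋀^Fin 2]→ₗ[ℝ] ℝ :=
    { toFun := fun v => ((φ.1 (j q)).toAlternatingMap.curryLeft v).compLinearMap
        (mfderiv (𝓡 6) (𝓡∂ 7) j q).toLinearMap
      map_add' := fun a b => by rw [map_add]; rfl
      map_smul' := fun c a => by rw [map_smul]; rfl }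
  have hle : Lambda1 μ φ j q ⊔ Lambda6 φ j q ≤ LinearMap.range L := by
    refine sup_le (Submodule.span_le.2 ?_) ?_
    · rintro _ ⟨ν, -, rfl⟩
      exact ⟨ν, rfl⟩
    · rintro _ ⟨u, rfl⟩
      exact ⟨mfderiv (𝓡 6) (𝓡∂ 7) j q u,
        (AlternatingMap.curryLeft_compLinearMap (mfderiv (𝓡 6) (𝓡∂ 7) j q).toLinearMap
          (φ.1 (j q)).toAlternatingMap u).symm⟩
  obtain ⟨v, hv⟩ := hle (hθ q)
  exact ⟨v, ContinuousAlternatingMap.ext fun w => (DFunLike.congr_fun hv w).symm⟩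

theorem exists_omega7_extension [T2Space M] [CompactSpace M]
    (hj : Manifold.IsSmoothEmbedding (𝓡 6) (𝓡∂ 7) ∞ j) (hc : IsClosed (range j))
    (hμ : ∀ x, μ.1 x ≠ 0)
    (hφ : ∀ x, IsPositive (μ.1 x).toAlternatingMap (φ.1 x).toAlternatingMap)
    {θ : Smooth (𝓡 6) N 2} (hθ : θ ∈ Omega7Bdry μ φ j) :
    ∃ α ∈ Omega7 φ, restrict (𝓡∂ 7) (𝓡 6) j 2 α.1 = θ.1 := by
  obtain ⟨α, hα, hαθ⟩ := exists_contraction_extension hj hc φ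
    (eq_zero_of_contract_comp_mfderiv_eq_zero hj hμ hφ) θ (exists_contract_of_mem_omega7Bdry hθ)
  refine ⟨α, fun x => ?_, hαθ⟩
  obtain ⟨v, hv⟩ := hα x
  exact ⟨v, by rw [hv]; rfl⟩

theorem mem_kerP_iff {θ : V μ φ j} : θ ∈ kerP μ φ j ↔
    ∃ (γ : Smooth (𝓡∂ 7) M 2) (η : Smooth (𝓡 6) N 1), d (𝓡∂ 7) M 2 γ = 0 ∧
      restrict (𝓡∂ 7) (𝓡 6) j 2 γ.1 - d (𝓡 6) N 1 η = -θ.1.1 := by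
  rw [kerP, LinearMap.mem_ker]
  refine (Submodule.Quotient.mk_eq_zero _).trans ?_
  constructor
  · rintro ⟨⟨γ, η⟩, h⟩
    exact ⟨γ, η, congrArg Prod.fst h, congrArg Prod.snd h⟩
  · rintro ⟨γ, η, h₁, h₂⟩
    exact ⟨(γ, η), Prod.ext h₁ h₂⟩

/-- A form in the kernel of `p` is the restriction of a closed form. -/
theorem exists_closed_extension [T2Space M] [CompactSpace M]
    (hj : Manifold.IsSmoothEmbedding (𝓡 6) (𝓡∂ 7) ∞ j) (hc : IsClosed (range j))
    {θ : V μ φ j} (hθ : θ ∈ kerP μ φ j) :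
    ∃ β : Smooth (𝓡∂ 7) M 2, d (𝓡∂ 7) M 2 β = 0 ∧
      restrict (𝓡∂ 7) (𝓡 6) j 2 β.1 = θ.1.1 := by
  obtain ⟨γ, η, hγ, hη⟩ := mem_kerP_iff.1 hθ
  obtain ⟨H, hH⟩ := exists_smooth_extension hj hc η
  have hdη : restrict (𝓡∂ 7) (𝓡 6) j 2 (d (𝓡∂ 7) M 1 H) = d (𝓡 6) N 1 η := by
    rw [← d_restrict H hj.contMDiff]
    congr 1
    exact Subtype.ext hH
  refine ⟨⟨d (𝓡∂ 7) M 1 H, extDerivField_mem_smooth H.2⟩ - γ, ?_, ?_⟩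
  · rw [map_sub, hγ, sub_zero]
    exact extDerivField_extDerivField H.2
  · change restrict (𝓡∂ 7) (𝓡 6) j 2 (d (𝓡∂ 7) M 1 H - γ.1) = _
    rw [map_sub, hdη, ← neg_sub, hη, neg_neg]

end G2Boundary

/-- Two surjective linear maps with the same kernel have isomorphic targets. -/
theorem LinearMap.exists_linearEquiv_of_ker_eq {R X Y Z : Type*} [Ring R] [AddCommGroup X]
    [Module R X] [AddCommGroup Y] [Module R Y] [AddCommGroup Z] [Module R Z] (f : X →ₗ[R] Y)
    (g : X →ₗ[R] Z) (hf : Function.Surjective f) (hg : Function.Surjective g)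
    (h : LinearMap.ker f = LinearMap.ker g) : ∃ e : Y ≃ₗ[R] Z, ∀ x, e (f x) = g x := by
  refine ⟨(f.quotKerEquivOfSurjective hf).symm ≪≫ₗ Submodule.quotEquivOfEq _ _ h ≪≫ₗ
    g.quotKerEquivOfSurjective hg, fun x => ?_⟩
  have : (f.quotKerEquivOfSurjective hf).symm (f x) = (LinearMap.ker f).mkQ x := by
    rw [LinearEquiv.symm_apply_eq]; rfl
  simp only [LinearEquiv.trans_apply, this]
  rfl

end

theorem proposition9
    -- `M` is a compact connected smooth 7-manifold with boundary
    {M : Type*} [TopologicalSpace M] [T2Space M] [CompactSpace M] [ConnectedSpace M]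
    [ChartedSpace (EuclideanHalfSpace 7) M] [IsManifold (𝓡∂ 7) ∞ M]
    -- `N`, with the inclusion `j`, is the boundary of `M` as a smooth 6-manifold; it is non-empty
    {N : Type*} [TopologicalSpace N] [Nonempty N]
    [ChartedSpace (EuclideanSpace ℝ (Fin 6)) N] [IsManifold (𝓡 6) ∞ N]
    (j : N → M) (hj : Manifold.IsSmoothEmbedding (𝓡 6) (𝓡∂ 7) ∞ j)
    (hrange : Set.range j = (𝓡∂ 7).boundary M)
    -- the orientation of `M` is given by a nowhere vanishing 7-form
    (μ : Forms.Smooth (𝓡∂ 7) M 7) (hμ : ∀ x, μ.1 x ≠ 0)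
    -- `φ` defines a torsion-free `G₂`-structure
    (φ : Forms.Smooth (𝓡∂ 7) M 3) (hφ : G2Boundary.IsTorsionFree μ φ) :
    -- there is an isomorphism, and it sends the class of `dα₇` to the class of `α₇|_∂M`
    ∃ e : G2Boundary.K j φ ≃ₗ[ℝ] G2Boundary.KerQuot μ φ j,
      ∀ (α : Forms.Smooth (𝓡∂ 7) M 2) (_ : α ∈ G2Boundary.Omega7 φ)
        (hK : Forms.d (𝓡∂ 7) M 2 α ∈ G2Boundary.KNum j φ),
        ∃ (θ : G2Boundary.kerP μ φ j),
          (θ.1.1.1 : Forms.FormField (𝓡 6) N 2) = Forms.restrict (𝓡∂ 7) (𝓡 6) j 2 α.1 ∧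
          e (Submodule.Quotient.mk ⟨Forms.d (𝓡∂ 7) M 2 α, hK⟩) = Submodule.Quotient.mk θ := by
  have hc : IsClosed (range j) := by
    rw [hrange]
    exact ModelWithCorners.isClosed_boundary (n := ∞) (by simp)
  have hj' : ContMDiff (𝓡 6) (𝓡∂ 7) ∞ j := hj.contMDiff
  let X : Submodule ℝ (Forms.Smooth (𝓡∂ 7) M 2) :=
    G2Boundary.Omega7 φ ⊓ (G2Boundary.KNum j φ).comap (Forms.d (𝓡∂ 7) M 2)
  let res : Forms.Smooth (𝓡∂ 7) M 2 →ₗ[ℝ] Forms.Smooth (𝓡 6) N 2 :=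
    LinearMap.codRestrict _ (Forms.restrict (𝓡∂ 7) (𝓡 6) j 2 ∘ₗ (Forms.Smooth (𝓡∂ 7) M 2).subtype)
      fun α => Forms.restrict_mem_smooth α.2 hj'
  have hdres : ∀ α, Forms.d (𝓡 6) N 2 (res α) =
      Forms.restrict (𝓡∂ 7) (𝓡 6) j 3 (Forms.d (𝓡∂ 7) M 2 α) := fun α =>
    Forms.d_restrict α hj'
  have hV : ∀ α : X, res α.1 ∈ G2Boundary.V μ φ j := by
    rintro ⟨α, hα, -, α', hα', hd⟩
    refine ⟨G2Boundary.restrict_mem_omega7Bdry hj hrange hμ hφ.positive hα, ?_⟩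
    have h₀ : res α' = 0 := Subtype.ext hα'
    change Forms.d (𝓡 6) N 2 (res α) = 0
    rw [hdres, ← hd, ← hdres, h₀, map_zero]
  let rV : X →ₗ[ℝ] G2Boundary.V μ φ j := LinearMap.codRestrict _ (res ∘ₗ X.subtype) hV
  have hP : ∀ α : X, rV α ∈ G2Boundary.kerP μ φ j := by
    rintro ⟨α, hα, hα₂⟩
    obtain ⟨-, α', hα', hd⟩ := id hα₂
    have h₀ : Forms.restrict (𝓡∂ 7) (𝓡 6) j 2 α'.1 = 0 := hα'
    refine G2Boundary.mem_kerP_iff.2 ⟨α' - α, 0, by rw [map_sub, hd, sub_self], ?_⟩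
    rw [map_zero, sub_zero]
    change Forms.restrict (𝓡∂ 7) (𝓡 6) j 2 (α'.1 - α.1) = -Forms.restrict (𝓡∂ 7) (𝓡 6) j 2 α.1
    rw [map_sub, h₀, zero_sub]
  let rP : X →ₗ[ℝ] G2Boundary.kerP μ φ j := LinearMap.codRestrict _ rV hP
  let dX : X →ₗ[ℝ] G2Boundary.KNum j φ :=
    LinearMap.codRestrict _ (Forms.d (𝓡∂ 7) M 2 ∘ₗ X.subtype) fun α => α.2.2
  suffices h : ∃ e : G2Boundary.K j φ ≃ₗ[ℝ] G2Boundary.KerQuot μ φ j,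
      ∀ α : X, e (Submodule.Quotient.mk (dX α)) = Submodule.Quotient.mk (rP α) by
    obtain ⟨e, he⟩ := h
    exact ⟨e, fun α hα hK => ⟨rP ⟨α, hα, hK⟩, rfl, he ⟨α, hα, hK⟩⟩⟩
  refine LinearMap.exists_linearEquiv_of_ker_eq
    (((G2Boundary.KDen j φ).submoduleOf (G2Boundary.KNum j φ)).mkQ ∘ₗ dX)
    (((G2Boundary.kerP μ φ j ⊓ G2Boundary.imIota μ φ j).submoduleOf
      (G2Boundary.kerP μ φ j)).mkQ ∘ₗ rP) ?_ ?_ ?_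
  · refine (Submodule.mkQ_surjective _).comp ?_
    rintro ⟨y, hy⟩
    obtain ⟨α, hα, rfl⟩ := id hy.1
    exact ⟨⟨α, hα, hy⟩, rfl⟩
  · refine (Submodule.mkQ_surjective _).comp ?_
    rintro ⟨θ, hθ⟩
    obtain ⟨α, hα, hαθ⟩ :=
      G2Boundary.exists_omega7_extension hj hc hμ hφ.positive θ.2.1
    obtain ⟨β, hβ, hβθ⟩ := G2Boundary.exists_closed_extension hj hc hθ
    have hrel : α - β ∈ Forms.SmoothRel (𝓡∂ 7) (𝓡 6) j 2 := by
      change Forms.restrict (𝓡∂ 7) (𝓡 6) j 2 (α.1 - β.1) = 0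
      rw [map_sub, hαθ, hβθ, sub_self]
    have hK : Forms.d (𝓡∂ 7) M 2 α ∈ G2Boundary.KNum j φ :=
      ⟨⟨α, hα, rfl⟩, ⟨α - β, hrel, by rw [map_sub, hβ, sub_zero]⟩⟩
    exact ⟨⟨α, hα, hK⟩, Subtype.ext (Subtype.ext (Subtype.ext hαθ))⟩
  · refine SetLike.ext ?_
    rintro ⟨α, hα, hK⟩
    refine (Submodule.Quotient.mk_eq_zero
      ((G2Boundary.KDen j φ).submoduleOf (G2Boundary.KNum j φ))).trans (Iff.trans ?_
      (Submodule.Quotient.mk_eq_zero ((G2Boundary.kerP μ φ j ⊓ G2Boundary.imIota μ φ j).submoduleOf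
        (G2Boundary.kerP μ φ j))).symm)
    constructor
    · rintro ⟨α', ⟨hα', hrel⟩, hd⟩
      have hr : Forms.restrict (𝓡∂ 7) (𝓡 6) j 2 α'.1 = 0 := hrel
      have hd' : Forms.d (𝓡∂ 7) M 2 α' = Forms.d (𝓡∂ 7) M 2 α := hd
      refine ⟨hP _, α - α', ⟨Submodule.sub_mem _ hα hα', ?_⟩, ?_⟩
      · change Forms.d (𝓡∂ 7) M 2 (α - α') = 0
        rw [map_sub, hd', sub_self]
      · change Forms.restrict (𝓡∂ 7) (𝓡 6) j 2 (α.1 - α'.1) =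
          Forms.restrict (𝓡∂ 7) (𝓡 6) j 2 α.1
        rw [map_sub, hr, sub_zero]
    · rintro ⟨-, w, ⟨hw, hdw⟩, hwα⟩
      have hwα' : Forms.restrict (𝓡∂ 7) (𝓡 6) j 2 w.1 =
        Forms.restrict (𝓡∂ 7) (𝓡 6) j 2 α.1 := hwα
      refine ⟨α - w, ⟨Submodule.sub_mem _ hα hw, ?_⟩, ?_⟩
      · change Forms.restrict (𝓡∂ 7) (𝓡 6) j 2 (α.1 - w.1) = 0
        rw [map_sub, hwα', sub_self]
      · have hdw' : Forms.d (𝓡∂ 7) M 2 w = 0 := hdw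
        rw [map_sub, hdw', sub_zero]
        rfl
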